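/- Let $G$ and $H$ be locally compact (Hausdorff) groups with fixed left Haar measures. The Fourier algebra $A(G)$ is the space of functions $f=\sum_{n}\langle\lambda(\cdot)\xi_n,\eta_n\rangle$ with $\xi_n,\eta_n\in L^2(G)$ and $\sum_n\|\xi_n\|\,\|\eta_n\|<\infty$, where $\lambda$ is the left regular representation of $G$, normed by the infimum of $\sum_n\|\xi_n\|\,\|\eta_n\|$ over all such expansions of $f$. Let $\mathcal I$ be a non-zero ideal of $A(G)$ whose support, the closure of $\{x\in G: u(x)\neq 0 \text{ for some } u\in\mathcal I\}$, is compact. Feichtinger's Segal algebra $S_0(G)$ is the range of $$q_{\mathcal I}:\ell^1(G)\,\widehat\otimes\,\mathcal I\to A(G),\qquad q_{\mathcal I}(x\otimes u)(t)=\sum_{s\in G}x(s)\,u(s^{-1}t),$$ where $\ell^1(G)$ carries its maximal operator space structure and $\widehat\otimes$ is the (completed) operator projective tensor product; that is, $S_0(G)$ is the space of all sums $\sum_n q_{\mathcal I}(x_n\otimes u_n)$ with $x_n\in\ell^1(G)$, $u_n\in\mathcal I$ and $\sum_n\|x_n\|_1\|u_n\|_{A(G)}<\infty$. Let $S_0(H)$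 be defined in the same way, by means of a non-zero ideal $\mathcal J$ of $A(H)$ with compact support. Let $\Phi:S_0(G)\to S_0(H)$ be a linear bijection, not assumed to be continuous, such that for all $u,v\in S_0(G)$ $$\Phi(uv)=\Phi u\;\Phi v\qquad\text{and}\qquad \Phi(u*v)=\Phi u*\Phi v,$$ where $uv$ is the pointwise product and $u*v(x)=\int_G u(y)\,v(y^{-1}x)\,dy$. Then there exists a map $\alpha:H\to G$ that is both a homeomorphism and a group isomorphism, such that $\Phi u=u\circ\alpha$ for all $u\in S_0(G)$. -/

import Mathlib

open MeasureTheory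
open scoped ComplexConjugate

noncomputable section

section FourierAlgebra

variable {G : Type*} [Group G] [MeasurableSpace G]

/-- The coefficient function `s ↦ ⟨λ(s) ξ, η⟩` of the left regular representation
`(λ(s) ξ)(t) = ξ(s⁻¹ t)` of `G` on `L²(G)`. -/
def regularCoeff (μ : Measure G) (ξ η : Lp ℂ 2 μ) : G → ℂ :=
  fun s => ∫ t, ξ (s⁻¹ * t) * conj (η t) ∂μ

/-- `f = ∑ₙ ⟨λ(·) ξₙ, ηₙ⟩` with `∑ₙ ‖ξₙ‖ ‖ηₙ‖ < ∞`. -/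
def IsCoeffExpansion (μ : Measure G) (f : G → ℂ) (ξ η : ℕ → Lp ℂ 2 μ) : Prop :=
  Summable (fun n => ‖ξ n‖ * ‖η n‖) ∧
    ∀ s, HasSum (fun n => regularCoeff μ (ξ n) (η n) s) (f s)

/-- The Fourier algebra `A(G)`: the space of all sums `∑ₙ ⟨λ(·) ξₙ, ηₙ⟩` of coefficient functions
of the left regular representation with `∑ₙ ‖ξₙ‖ ‖ηₙ‖ < ∞` (the predual of the group von Neumann
algebra, realised as a space of functions on `G`). -/
def fourierAlgebra (μ : Measure G) : Set (G → ℂ) :=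
  {f | ∃ ξ η : ℕ → Lp ℂ 2 μ, IsCoeffExpansion μ f ξ η}

/-- The norm of `A(G)`: the infimum of `∑ₙ ‖ξₙ‖ ‖ηₙ‖` over all expansions
`f = ∑ₙ ⟨λ(·) ξₙ, ηₙ⟩`. It is only used for functions `f` in `A(G)`. -/
def fourierNorm (μ : Measure G) (f : G → ℂ) : ℝ :=
  sInf {c | ∃ ξ η : ℕ → Lp ℂ 2 μ, IsCoeffExpansion μ f ξ η ∧ c = ∑' n, ‖ξ n‖ * ‖η n‖}

/-- A non-zero ideal of `A(G)` with compact support. The Gelfand spectrum of `A(G)` is `G` (acting by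
point evaluations), the hull of `I` is the set of common zeros of `I`, and the support of `I`
is the closure of the complement of its hull. The ideal is not required to be closed. -/
structure IsCompactlySupportedIdeal [TopologicalSpace G] (μ : Measure G)
    (I : Submodule ℂ (G → ℂ)) : Prop where
  subset : (I : Set (G → ℂ)) ⊆ fourierAlgebra μ
  mul_mem : ∀ a ∈ fourierAlgebra μ, ∀ u ∈ I, a * u ∈ I
  ne_bot : I ≠ ⊥
  compact_support : IsCompact (closure {x : G | ∀ u ∈ I, u x = 0}ᶜ)

end FourierAlgebra

section SegalAlgebra

variable {G : Type*} [Group G]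

/-- The action `q(x ⊗ u) = ∑ₛ x(s) s·u` of `x ∈ ℓ¹(G)` on a function `u`,
where `(s·u)(t) = u(s⁻¹ t)`. -/
def ellOneAct (x : lp (fun _ : G => ℂ) 1) (u : G → ℂ) : G → ℂ :=
  fun t => ∑' s, x s * u (s⁻¹ * t)

/-- `f = ∑ₙ q(xₙ ⊗ uₙ)` with `xₙ ∈ ℓ¹(G)`, `uₙ ∈ I` and `∑ₙ ‖xₙ‖ ‖uₙ‖_{A(G)} < ∞`. -/
def IsTensorExpansion [MeasurableSpace G] (μ : Measure G) (I : Submodule ℂ (G → ℂ)) (f : G → ℂ)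
    (x : ℕ → lp (fun _ : G => ℂ) 1) (u : ℕ → G → ℂ) : Prop :=
  (∀ n, u n ∈ I) ∧ Summable (fun n => ‖x n‖ * fourierNorm μ (u n)) ∧
    ∀ t, HasSum (fun n => ellOneAct (x n) (u n) t) (f t)

/-- The two sequences `a` and `b` merged into one. -/
def mergeSeq {α : Type*} (a b : ℕ → α) : ℕ → α :=
  fun n => Sum.elim a b (Equiv.natSumNatEquivNat.symm n)

theorem hasSum_mergeSeq {α β E : Type*} [NormedAddCommGroup E]
    (F : α → β → E) {a a' : ℕ → α} {b b' : ℕ → β} {s s' : E}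
    (h : HasSum (fun n => F (a n) (b n)) s) (h' : HasSum (fun n => F (a' n) (b' n)) s') :
    HasSum (fun n => F (mergeSeq a a' n) (mergeSeq b b' n)) (s + s') := by
  rw [← Equiv.natSumNatEquivNat.hasSum_iff]
  refine HasSum.sum (f := _) ?_ ?_ <;> simpa [mergeSeq, Function.comp_def] using by assumption

/-- Feichtinger's Segal algebra `S₀(G) = ran(q_I)`, the range of
`q_I : ℓ¹(G) ⊗̂ I → A(G)`, `q_I(x ⊗ u) = ∑ₛ x(s) s·u`, for a non-zero ideal `I` of `A(G)` with
compact support. Since `ℓ¹(G)` carries its maximal operator space structure, every bounded map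
out of it is completely bounded with the same norm, so the operator projective tensor product
`ℓ¹(G) ⊗̂ I` is, as a Banach space, the completed projective tensor product, whose elements are the
series `∑ₙ xₙ ⊗ uₙ` with `∑ₙ ‖xₙ‖ ‖uₙ‖ < ∞`. Convergence in `A(G)` implies pointwise
convergence, so the image of such a series is the pointwise sum of the `q_I(xₙ ⊗ uₙ)`. -/
def segalAlgebra [MeasurableSpace G] (μ : Measure G) (I : Submodule ℂ (G → ℂ)) :
    Submodule ℂ (G → ℂ) where
  carrier := {f | ∃ x u, IsTensorExpansion μ I f x u}
  zero_mem' := ⟨0, 0, fun _ => I.zero_mem, by simp,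
    fun t => by simp [ellOneAct]⟩
  add_mem' := by
    rintro f g ⟨x, u, hu, hs, hf⟩ ⟨y, v, hv, hs', hg⟩
    refine ⟨mergeSeq x y, mergeSeq u v, fun n => ?_, ?_, fun t => ?_⟩
    · unfold mergeSeq
      cases Equiv.natSumNatEquivNat.symm n with
      | inl k => exact hu k
      | inr k => exact hv k
    · exact (hasSum_mergeSeq (fun a b => ‖a‖ * fourierNorm μ b) hs.hasSum hs'.hasSum).summable
    · exact hasSum_mergeSeq (fun a b => ellOneAct a b t) (hf t) (hg t)
  smul_mem' := by
    rintro c f ⟨x, u, hu, hs, hf⟩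
    refine ⟨fun n => c • x n, u, hu, ?_, fun t => ?_⟩
    · simpa [norm_smul, mul_assoc] using hs.mul_left ‖c‖
    · simpa [ellOneAct, mul_assoc, tsum_mul_left] using (hf t).mul_left c

/-- The convolution `(u ∗ v)(x) = ∫ u(y) v(y⁻¹ x) dy`. -/
def groupConv [MeasurableSpace G] (μ : Measure G) (u v : G → ℂ) : G → ℂ :=
  fun x => ∫ y, u y * v (y⁻¹ * x) ∂μ

end SegalAlgebra

end

/-!
The proof identifies the characters of `S₀(G)` and then compares convolutions of functions with
small support.

*The algebra `A(G)`.* Norms are handled through `FourierBound μ f c`, the existence of an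
expansion of `f` of mass at most `c`. Completeness (`FourierBound.of_hasSum`) is then a
rearrangement of double series. Coefficient functions of the left regular representation on the
vector-valued space `L²(G; E)` still lie in `A(G)` (`fourierBound_vectorCoeff`), by expanding in
an orthonormal basis of `E`. Since `⟨λ(s) ξ', η'⟩ = ⟨λ(t⁻¹ s) ξ', λ(t⁻¹) η'⟩` for every `t`, the
product of two coefficient functions is such a vector-valued coefficient with `E = L²(G)`. This
gives the algebra structure (`FourierBound.mul`). The same identity, with a normalised indicator
function of a small set as one of the factors, shows that `u - u(x)` has small norm locally at `x`
(`FourierBound.exists_local_small`): points are sets of synthesis.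

*Ideals.* By synthesis and a Neumann series, an element of `A(G)` not vanishing at `x` is
invertible near `x`. Compactness then shows that an ideal of `A(G)` without common zeros, closed
or not, contains all compactly supported elements of `A(G)` (`mem_ideal_of_hasCompactSupport`). In
particular `S₀(G)`, which is an ideal of `A(G)`, contains them.

*Characters.* Let `χ` be a non-zero multiplicative functional on `S₀(G)`. If its kernel had no
common zero, `χ` would vanish on all compactly supported elements. As these are dense in `A(G)`,
`χ` would take the value `1` at some `w` of small norm, which contradicts the invertibility of
`1 - w`. So `χ` is a point evaluation (`exists_eq_eval_of_multiplicative`). No continuity is assumed,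
only completeness of `A(G)` is used. Applied to `u ↦ Φ u (h)` and to the inverse of `Φ`, this
yields a homeomorphism `α` with `Φ u = u ∘ α`.

*Convolution.* If `α(k⁻¹ h) ≠ α(k)⁻¹ α(h)`, there are non-negative `u` and `v`, supported near
`α(k)` and `α(k)⁻¹ α(h)`, such that `u ∗ v` is positive at `α(h)` whereas `(u ∘ α) ∗ (v ∘ α)`
vanishes at `h` (`map_inv_mul_of_groupConv`).
-/

open Filter Topology Set
open scoped ENNReal Pointwise

/-! ### Norm bounds in the Fourier algebra -/

section Coefficients

variable {G : Type*} [Group G] [MeasurableSpace G]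

/-- `FourierBound μ f c` says that `f` has an expansion into coefficient functions of total mass at
most `c`. So `f` lies in `A(G)`, with norm at most `c`. -/
def FourierBound (μ : Measure G) (f : G → ℂ) (c : ℝ) : Prop :=
  ∃ ξ η : ℕ → Lp ℂ 2 μ, IsCoeffExpansion μ f ξ η ∧ ∑' n, ‖ξ n‖ * ‖η n‖ ≤ c

variable {μ : Measure G} {f g : G → ℂ} {c d : ℝ}

theorem mem_fourierAlgebra_iff : f ∈ fourierAlgebra μ ↔ ∃ c, FourierBound μ f c :=
  ⟨fun ⟨ξ, η, h⟩ => ⟨_, ξ, η, h, le_rfl⟩, fun ⟨_, ξ, η, h, _⟩ => ⟨ξ, η, h⟩⟩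

theorem FourierBound.mem (h : FourierBound μ f c) : f ∈ fourierAlgebra μ :=
  mem_fourierAlgebra_iff.2 ⟨c, h⟩

theorem FourierBound.nonneg (h : FourierBound μ f c) : 0 ≤ c := by
  obtain ⟨ξ, η, _, h⟩ := h
  exact (tsum_nonneg fun n => by positivity).trans h

theorem FourierBound.mono (h : FourierBound μ f c) (hcd : c ≤ d) : FourierBound μ f d := by
  obtain ⟨ξ, η, h, h'⟩ := h
  exact ⟨ξ, η, h, h'.trans hcd⟩

theorem fourierNorm_nonneg (f : G → ℂ) : 0 ≤ fourierNorm μ f := by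
  refine Real.sInf_nonneg ?_
  rintro _ ⟨ξ, η, _, rfl⟩
  exact tsum_nonneg fun n => by positivity

theorem FourierBound.fourierNorm_le (h : FourierBound μ f c) : fourierNorm μ f ≤ c := by
  obtain ⟨ξ, η, h, h'⟩ := h
  have hle : fourierNorm μ f ≤ ∑' n, ‖ξ n‖ * ‖η n‖ := by
    refine csInf_le ⟨0, ?_⟩ ⟨ξ, η, h, rfl⟩
    rintro _ ⟨ξ, η, _, rfl⟩
    exact tsum_nonneg fun n => by positivity
  exact hle.trans h'

theorem fourierBound_of_fourierNorm_lt (hf : f ∈ fourierAlgebra μ) (h : fourierNorm μ f < c) :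
    FourierBound μ f c := by
  obtain ⟨ξ₀, η₀, h₀⟩ := hf
  have hne : {c | ∃ ξ η : ℕ → Lp ℂ 2 μ, IsCoeffExpansion μ f ξ η ∧
      c = ∑' n, ‖ξ n‖ * ‖η n‖}.Nonempty := ⟨_, ξ₀, η₀, h₀, rfl⟩
  obtain ⟨_, ⟨ξ, η, hexp, rfl⟩, hlt⟩ := exists_lt_of_csInf_lt hne h
  exact ⟨ξ, η, hexp, hlt.le⟩

end Coefficients

section FourierBound

variable {G : Type*} [Group G] [TopologicalSpace G] [IsTopologicalGroup G]
  [MeasurableSpace G] [BorelSpace G] {μ : Measure G} [μ.IsMulLeftInvariant]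
  {f g : G → ℂ} {c d : ℝ}

/-- The translate `λ(s) ξ` is encoded as `DomMulAct.mk s⁻¹ • ξ`, as `DomMulAct.mk s` acts on
functions by composition with `t ↦ s t`. -/
theorem regularCoeff_eq_inner (ξ η : Lp ℂ 2 μ) (s : G) :
    regularCoeff μ ξ η s = inner ℂ η (DomMulAct.mk s⁻¹ • ξ) := by
  rw [L2.inner_def]
  refine integral_congr_ae ?_
  filter_upwards [DomMulAct.smul_Lp_ae_eq (DomMulAct.mk s⁻¹) ξ] with t ht
  rw [ht]; simp

theorem inner_mk_smul_Lp (t : G) (ξ η : Lp ℂ 2 μ) :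
    inner ℂ (DomMulAct.mk t • ξ) (DomMulAct.mk t • η) = inner ℂ ξ η := by
  rw [L2.inner_def, L2.inner_def,
    ← integral_mul_left_eq_self (fun r => inner ℂ (ξ r) (η r)) t]
  refine integral_congr_ae ?_
  filter_upwards [DomMulAct.smul_Lp_ae_eq (DomMulAct.mk t) ξ,
    DomMulAct.smul_Lp_ae_eq (DomMulAct.mk t) η] with r h1 h2
  rw [h1, h2]; simp

/-- The identity behind Fell's absorption principle: the coefficient `⟨λ(s) ξ, η⟩` can be read off
from the translates of `ξ` and `η` by `s⁻¹ t` and `t`, for any `t`. -/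
theorem inner_translates_eq_regularCoeff (ξ η : Lp ℂ 2 μ) (s t : G) :
    inner ℂ (DomMulAct.mk t • η) (DomMulAct.mk (s⁻¹ * t) • ξ) = regularCoeff μ ξ η s := by
  rw [DomMulAct.mk_mul, mul_smul, inner_mk_smul_Lp, regularCoeff_eq_inner]

theorem integral_inner_translates (ξ η : Lp ℂ 2 μ) (φ ψ : G → ℂ) (s : G) :
    ∫ t, inner ℂ (ψ t • DomMulAct.mk t • η) (φ (s⁻¹ * t) • DomMulAct.mk (s⁻¹ * t) • ξ) ∂μ =
      (∫ t, φ (s⁻¹ * t) * conj (ψ t) ∂μ) * regularCoeff μ ξ η s := by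
  rw [← integral_mul_const]
  congr with t
  rw [inner_smul_left, inner_smul_right, inner_translates_eq_regularCoeff]
  ring

theorem regularCoeff_toLp {φ ψ : G → ℂ} (hφ : MemLp φ 2 μ) (hψ : MemLp ψ 2 μ) (s : G) :
    regularCoeff μ (hφ.toLp φ) (hψ.toLp ψ) s = ∫ t, φ (s⁻¹ * t) * conj (ψ t) ∂μ := by
  refine integral_congr_ae ?_
  filter_upwards [hψ.coeFn_toLp, (measurePreserving_mul_left μ s⁻¹).quasiMeasurePreserving.ae
    hφ.coeFn_toLp] with t h1 h2
  rw [h1, h2]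

theorem norm_regularCoeff_le (ξ η : Lp ℂ 2 μ) (s : G) :
    ‖regularCoeff μ ξ η s‖ ≤ ‖ξ‖ * ‖η‖ := by
  rw [regularCoeff_eq_inner, mul_comm]
  simpa using norm_inner_le_norm (𝕜 := ℂ) η (DomMulAct.mk s⁻¹ • ξ)

theorem FourierBound.norm_le (h : FourierBound μ f c) (s : G) : ‖f s‖ ≤ c := by
  obtain ⟨ξ, η, ⟨hs, hf⟩, h⟩ := h
  rw [← (hf s).tsum_eq]
  refine (tsum_of_norm_bounded hs.hasSum fun n => norm_regularCoeff_le _ _ s).trans h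

/-- Expansions may be indexed by any countable type: they are extended by zero to `ℕ`. -/
theorem fourierBound_of_countable {ι : Type*} [Countable ι] {ξ η : ι → Lp ℂ 2 μ}
    (hs : Summable fun i => ‖ξ i‖ * ‖η i‖)
    (hf : ∀ s, HasSum (fun i => regularCoeff μ (ξ i) (η i) s) (f s)) :
    FourierBound μ f (∑' i, ‖ξ i‖ * ‖η i‖) := by
  obtain ⟨e, he⟩ := exists_injective_nat ι
  have key : ∀ {β : Type _} [AddCommMonoid β] (F : Lp ℂ 2 μ → Lp ℂ 2 μ → β), F 0 0 = 0 →
      (fun n => F (Function.extend e ξ 0 n) (Function.extend e η 0 n)) =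
        Function.extend e (fun i => F (ξ i) (η i)) 0 := by
    intro β _ F hF
    funext n
    by_cases hn : ∃ i, e i = n
    · obtain ⟨i, rfl⟩ := hn
      simp [he.extend_apply]
    · simp [Function.extend_apply' _ _ _ hn, hF]
  have h1 := (hasSum_extend_zero he).2 hs.hasSum
  rw [← key (fun a b => ‖a‖ * ‖b‖) (by simp)] at h1
  refine ⟨Function.extend e ξ 0, Function.extend e η 0, ⟨h1.summable, fun s => ?_⟩, h1.tsum_eq.le⟩
  have h2 := (hasSum_extend_zero he).2 (hf s)
  rwa [← key (fun a b => regularCoeff μ a b s) (by simp [regularCoeff_eq_inner])] at h2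

theorem fourierBound_regularCoeff (ξ η : Lp ℂ 2 μ) :
    FourierBound μ (regularCoeff μ ξ η) (‖ξ‖ * ‖η‖) := by
  have := fourierBound_of_countable (ι := Unit) (ξ := fun _ => ξ) (η := fun _ => η)
    (f := regularCoeff μ ξ η) (hasSum_fintype _).summable (fun s => by simp)
  simpa using this

/-- Completeness of `A(G)`: a series of elements with summable bounds on their norms converges. -/
theorem FourierBound.of_hasSum {ι : Type*} [Countable ι] {F : ι → G → ℂ} {c : ι → ℝ}
    (h : ∀ i, FourierBound μ (F i) (c i)) (hc : Summable c)
    (hf : ∀ s, HasSum (fun i => F i s) (f s)) : FourierBound μ f (∑' i, c i) := by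
  choose ξ η hexp hle using h
  have hs : Summable fun p : ι × ℕ => ‖ξ p.1 p.2‖ * ‖η p.1 p.2‖ := by
    refine (summable_prod_of_nonneg fun p => by positivity).2 ⟨fun i => (hexp i).1, ?_⟩
    exact hc.of_nonneg_of_le (fun i => tsum_nonneg fun n => by positivity) hle
  refine (fourierBound_of_countable (ι := ι × ℕ) (ξ := fun p => ξ p.1 p.2)
    (η := fun p => η p.1 p.2) hs fun s => ?_).mono ?_
  · have h1 : Summable fun p : ι × ℕ => regularCoeff μ (ξ p.1 p.2) (η p.1 p.2) s :=
      hs.of_norm_bounded fun p => norm_regularCoeff_le _ _ s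
    have h2 := h1.hasSum.prod_fiberwise (fun i => (hexp i).2 s)
    rw [(hf s).unique h2]
    exact h1.hasSum
  · rw [hs.tsum_prod' fun i => (hexp i).1]
    exact Summable.tsum_le_tsum hle hs.prod hc

theorem FourierBound.zero : FourierBound μ (0 : G → ℂ) 0 := by
  simpa using FourierBound.of_hasSum (μ := μ) (ι := Empty) (F := fun _ => 0) (c := 0) (f := 0)
    (fun i => i.elim) summable_zero (fun s => by simp)

theorem FourierBound.add (hf : FourierBound μ f c) (hg : FourierBound μ g d) :
    FourierBound μ (f + g) (c + d) := by
  have := FourierBound.of_hasSum (μ := μ) (ι := Bool) (F := fun b => cond b f g)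
    (c := fun b => cond b c d) (f := f + g) (fun b => by cases b <;> assumption)
    (hasSum_fintype _).summable
    (fun s => by simpa using hasSum_fintype (fun b : Bool => (cond b f g) s))
  simpa using this

theorem FourierBound.smul (hf : FourierBound μ f c) (a : ℂ) :
    FourierBound μ (a • f) (‖a‖ * c) := by
  obtain ⟨ξ, η, ⟨hs, hf⟩, h⟩ := hf
  refine ⟨fun n => a • ξ n, η, ⟨?_, fun s => ?_⟩, ?_⟩
  · simpa [norm_smul, mul_assoc] using hs.mul_left ‖a‖
  · have := (hf s).mul_left a
    simpa [regularCoeff_eq_inner, smul_comm _ a, inner_smul_right] using this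
  · simp only [norm_smul, mul_assoc, tsum_mul_left]
    gcongr

theorem FourierBound.neg (hf : FourierBound μ f c) : FourierBound μ (-f) c := by
  simpa using hf.smul (-1)

theorem FourierBound.sub (hf : FourierBound μ f c) (hg : FourierBound μ g d) :
    FourierBound μ (f - g) (c + d) := by
  simpa [sub_eq_add_neg] using hf.add hg.neg

theorem FourierBound.translate (hf : FourierBound μ f c) (r : G) :
    FourierBound μ (fun t => f (r * t)) c := by
  obtain ⟨ξ, η, ⟨hs, hf⟩, h⟩ := hf
  refine ⟨ξ, fun n => DomMulAct.mk r • η n, ⟨by simpa using hs, fun s => ?_⟩, by simpa using h⟩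
  convert hf (r * s) using 2 with n
  unfold regularCoeff
  rw [← integral_mul_left_eq_self (fun t => (ξ n) ((r * s)⁻¹ * t) * conj ((η n) t)) r]
  refine integral_congr_ae ?_
  filter_upwards [DomMulAct.smul_Lp_ae_eq (DomMulAct.mk r) (η n)] with t ht
  rw [ht]; simp [mul_assoc]

end FourierBound

/-! ### Vector-valued coefficient functions -/

section VectorCoefficients

variable {α E : Type*} {m : MeasurableSpace α} {μ : Measure α}
  [NormedAddCommGroup E] [InnerProductSpace ℂ E]

/-- A strongly measurable function into a Hilbert space has only countably many coordinates that
do not vanish almost everywhere, uniformly in the point. -/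
theorem exists_countable_coordinates {ι : Type*} (b : HilbertBasis ι ℂ E) {X : α → E}
    (hX : AEStronglyMeasurable X μ) :
    ∃ C : Set ι, C.Countable ∧ ∀ᵐ t ∂μ, ∀ i ∉ C, inner ℂ (b i) (X t) = 0 := by
  obtain ⟨R, ⟨D, hD, hRD⟩, hR⟩ := hX.isSeparable_ae_range
  refine ⟨⋃ v ∈ D, {i | inner ℂ (b i) v ≠ 0}, hD.biUnion fun v _ => ?_, ?_⟩
  · refine (b.summable_inner_mul_inner v v).countable_support.mono fun i hi => ?_
    simpa [Function.mem_support, inner_eq_zero_symm] using hi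
  · filter_upwards [hR] with t ht i hi
    have hcl : IsClosed {v : E | inner ℂ (b i) v = 0} :=
      isClosed_eq (by fun_prop) continuous_const
    have hsub : D ⊆ {v : E | inner ℂ (b i) v = 0} := fun v hv => by
      by_contra h
      exact hi (mem_biUnion hv h)
    exact closure_minimal hsub hcl (hRD ht)

theorem Lp_norm_sq_eq_integral (f : Lp E 2 μ) : ‖f‖ ^ 2 = ∫ t, ‖f t‖ ^ 2 ∂μ := by
  have h : ((‖f‖ ^ 2 : ℝ) : ℂ) = ((∫ t, ‖f t‖ ^ 2 ∂μ : ℝ) : ℂ) := by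
    rw [← integral_complex_ofReal]
    have := inner_self_eq_norm_sq_to_K (𝕜 := ℂ) f
    rw [L2.inner_def] at this
    simpa [inner_self_eq_norm_sq_to_K] using this.symm
  exact_mod_cast h

theorem integrable_norm_sq_Lp {F : Type*} [NormedAddCommGroup F] (f : Lp F 2 μ) :
    Integrable (fun t => ‖f t‖ ^ 2) μ :=
  (Lp.memLp f).integrable_norm_pow two_ne_zero

/-- Bessel's inequality, integrated. -/
theorem sum_norm_sq_coordinate_le {ι : Type*} {b : ι → E} (hb : Orthonormal ℂ b) (f : Lp E 2 μ)
    (u : Finset ι) : ∑ i ∈ u, ‖(innerSL ℂ (b i)).compLp f‖ ^ 2 ≤ ‖f‖ ^ 2 := by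
  simp_rw [Lp_norm_sq_eq_integral]
  rw [← integral_finsetSum _ fun i _ => integrable_norm_sq_Lp _]
  refine integral_mono_ae (integrable_finsetSum _ fun i _ => integrable_norm_sq_Lp _)
    (integrable_norm_sq_Lp _) ?_
  have : ∀ᵐ t ∂μ, ∀ i ∈ u, (innerSL ℂ (b i)).compLp f t = inner ℂ (b i) (f t) :=
    (Finset.eventually_all u).2 fun i _ => (innerSL ℂ (b i)).coeFn_compLp f
  filter_upwards [this] with t ht
  rw [Finset.sum_congr rfl fun i hi => by rw [ht i hi]]
  exact hb.sum_inner_products_le _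

theorem integral_norm_mul_le_eLpNorm {f g : α → ℂ} (hf : MemLp f 2 μ) (hg : MemLp g 2 μ) :
    ∫ t, ‖f t * g t‖ ∂μ ≤ (eLpNorm f 2 μ).toReal * (eLpNorm g 2 μ).toReal := by
  have h : eLpNorm (f • g) 1 μ ≤ eLpNorm f 2 μ * eLpNorm g 2 μ :=
    eLpNorm_smul_le_mul_eLpNorm hg.1 hf.1
  rw [integral_norm_eq_lintegral_enorm (f := fun t => f t * g t) (hf.1.mul hg.1),
    ← ENNReal.toReal_mul]
  rw [eLpNorm_one_eq_lintegral_enorm] at h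
  exact ENNReal.toReal_mono (ENNReal.mul_ne_top hf.eLpNorm_ne_top hg.eLpNorm_ne_top) h

theorem integral_norm_mul_le_Lp (f g : Lp ℂ 2 μ) : ∫ t, ‖f t * g t‖ ∂μ ≤ ‖f‖ * ‖g‖ := by
  simpa only [Lp.norm_def] using integral_norm_mul_le_eLpNorm (Lp.memLp f) (Lp.memLp g)

theorem norm_smul_le_of_ne_zero {ξ : α → ℂ} {P : α → E} {a : ℝ}
    (hPa : ∀ t, ξ t ≠ 0 → ‖P t‖ ≤ a) (t : α) : ‖ξ t • P t‖ ≤ a * ‖ξ t‖ := by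
  rw [norm_smul, mul_comm]
  by_cases h : ξ t = 0
  · simp [h]
  · exact mul_le_mul_of_nonneg_right (hPa t h) (norm_nonneg _)

theorem eLpNorm_smul_toReal_le {ξ : α → ℂ} (hξ : MemLp ξ 2 μ) {P : α → E} {a : ℝ} (ha : 0 ≤ a)
    (hPa : ∀ t, ξ t ≠ 0 → ‖P t‖ ≤ a) :
    (eLpNorm (fun t => ξ t • P t) 2 μ).toReal ≤ a * (eLpNorm ξ 2 μ).toReal := by
  have h := eLpNorm_le_mul_eLpNorm_of_ae_le_mul (μ := μ)
    (Eventually.of_forall (norm_smul_le_of_ne_zero hPa)) 2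
  refine (ENNReal.toReal_mono (ENNReal.mul_ne_top ENNReal.ofReal_ne_top hξ.eLpNorm_ne_top)
    h).trans_eq ?_
  rw [ENNReal.toReal_mul, ENNReal.toReal_ofReal ha]

theorem memLp_indicator_one {S : Set α} (hS : MeasurableSet S) (hμS : μ S ≠ ∞) :
    MemLp (S.indicator fun _ => (1 : ℂ)) 2 μ :=
  memLp_indicator_const 2 hS 1 (Or.inr hμS)

theorem eLpNorm_indicator_one_toReal {S : Set α} (hS : MeasurableSet S) :
    (eLpNorm (S.indicator fun _ => (1 : ℂ)) 2 μ).toReal = √(μ.real S) := by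
  rw [eLpNorm_indicator_const hS two_ne_zero (by simp), Real.sqrt_eq_rpow]
  simp [Measure.real, ENNReal.toReal_rpow]

/-- The approximating functions are not continuous, so that no normality of the space is needed. -/
theorem exists_hasCompactSupport_eLpNorm_sub_le [TopologicalSpace α] [BorelSpace α]
    [R1Space α] [μ.Regular] {ξ : α → ℂ} (hξ : MemLp ξ 2 μ) {ε : ℝ≥0∞}
    (hε : ε ≠ 0) : ∃ φ : α → ℂ, eLpNorm (ξ - φ) 2 μ ≤ ε ∧ MemLp φ 2 μ ∧ HasCompactSupport φ := by
  refine hξ.induction_dense (by simp) (fun φ => MemLp φ 2 μ ∧ HasCompactSupport φ) ?_ ?_ ?_ hε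
  · intro c t ht htμ ε hε
    obtain ⟨δ, hδ, h⟩ := exists_eLpNorm_indicator_le (μ := μ) (p := 2) (by simp) c hε
    obtain ⟨K, hKt, hK, hKc, hKμ⟩ := ht.exists_isCompact_isClosed_sdiff_lt htμ.ne
      (ENNReal.coe_pos.2 hδ).ne'
    refine ⟨K.indicator fun _ => c, ?_, memLp_indicator_const 2 hKc.measurableSet c
      (Or.inr hK.measure_lt_top.ne), ?_⟩
    · rw [← eLpNorm_neg, neg_sub, ← indicator_sdiff hKt]
      exact h _ hKμ.le
    · exact HasCompactSupport.intro hK fun t ht => indicator_of_notMem ht _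
  · exact fun f g hf hg => ⟨hf.1.add hg.1, hf.2.add hg.2⟩
  · exact fun f hf => hf.1.1

/-- Measurability is not automatic, since `P` may have non-separable range; but `ξ` is a limit of
compactly supported functions. -/
theorem aestronglyMeasurable_smul_of_memLp [TopologicalSpace α] [BorelSpace α]
    [R1Space α] [μ.Regular] {ξ : α → ℂ} (hξ : MemLp ξ 2 μ) {P : α → E}
    (hP : Continuous P) : AEStronglyMeasurable (fun t => ξ t • P t) μ := by
  have h : ∀ n : ℕ, ∃ φ : α → ℂ, eLpNorm (ξ - φ) 2 μ ≤ (n : ℝ≥0∞)⁻¹ ∧ MemLp φ 2 μ ∧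
      HasCompactSupport φ := fun n => exists_hasCompactSupport_eLpNorm_sub_le hξ (by simp)
  choose φ hφ hφL hφc using h
  have htend : TendstoInMeasure μ φ atTop ξ := by
    refine tendstoInMeasure_of_tendsto_eLpNorm two_ne_zero (fun n => (hφL n).1) hξ.1 ?_
    refine tendsto_of_tendsto_of_tendsto_of_le_of_le tendsto_const_nhds
      ENNReal.tendsto_inv_nat_nhds_zero (fun n => zero_le) fun n => ?_
    dsimp only
    rw [eLpNorm_sub_comm]
    exact hφ n
  obtain ⟨k, -, hk⟩ := htend.exists_seq_tendsto_ae
  refine aestronglyMeasurable_of_tendsto_ae atTop (f := fun n t => φ (k n) t • P t)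
    (fun n => ?_) (hk.mono fun t ht => ht.smul_const _)
  have hK : IsCompact (tsupport (φ (k n))) := hφc (k n)
  have hKm : MeasurableSet (tsupport (φ (k n))) := (isClosed_tsupport _).measurableSet
  have h1 : (tsupport (φ (k n))).indicator (fun t => φ (k n) t • P t) =
      fun t => φ (k n) t • P t :=
    indicator_eq_self.2 fun t ht => subset_tsupport _ fun h0 => ht (by simp [h0])
  rw [← h1, aestronglyMeasurable_indicator_iff hKm]
  exact (hφL (k n)).1.restrict.smul (hP.continuousOn.aestronglyMeasurable_of_isCompact hK hKm)

theorem memLp_smul_of_bound [TopologicalSpace α] [BorelSpace α] [R1Space α] [μ.Regular]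
    {ξ : α → ℂ} (hξ : MemLp ξ 2 μ) {P : α → E} (hP : Continuous P)
    {a : ℝ} (hPa : ∀ t, ξ t ≠ 0 → ‖P t‖ ≤ a) : MemLp (fun t => ξ t • P t) 2 μ :=
  hξ.of_le_mul (aestronglyMeasurable_smul_of_memLp hξ hP)
    (Eventually.of_forall (norm_smul_le_of_ne_zero hPa))

theorem exists_hasCompactSupport_Lp_near [TopologicalSpace α] [BorelSpace α] [R1Space α] [μ.Regular]
    (ξ : Lp ℂ 2 μ) {δ : ℝ} (hδ : 0 < δ) :
    ∃ (φ : α → ℂ) (hφ : MemLp φ 2 μ), HasCompactSupport φ ∧ ‖ξ - hφ.toLp φ‖ ≤ δ := by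
  obtain ⟨φ, hφ, hL, hc⟩ := exists_hasCompactSupport_eLpNorm_sub_le (Lp.memLp ξ)
    (ENNReal.ofReal_pos.2 hδ).ne'
  refine ⟨φ, hL, hc, ?_⟩
  have h : ξ - hL.toLp φ = ((Lp.memLp ξ).sub hL).toLp _ := by
    rw [MemLp.toLp_sub (Lp.memLp ξ) hL, Lp.toLp_coeFn]
  rw [h, Lp.norm_toLp]
  exact ENNReal.toReal_le_of_le_ofReal hδ.le hφ

end VectorCoefficients

section VectorFourierBound

variable {G : Type*} [Group G] [TopologicalSpace G] [IsTopologicalGroup G]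
  [MeasurableSpace G] [BorelSpace G] {μ : Measure G} [μ.IsMulLeftInvariant]
  {E : Type*} [NormedAddCommGroup E] [InnerProductSpace ℂ E] [CompleteSpace E]

/-- A coefficient function of the left regular representation on the vector-valued space
`L²(G; E)` lies in `A(G)`: its expansion is given by the coordinates in an orthonormal basis
of `E`, of which only countably many matter. -/
theorem fourierBound_vectorCoeff (X Y : Lp E 2 μ) :
    FourierBound μ (fun s => ∫ t, inner ℂ (Y t) (X (s⁻¹ * t)) ∂μ) (‖X‖ * ‖Y‖) := by
  obtain ⟨w, b, -⟩ := exists_hilbertBasis ℂ E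
  obtain ⟨C, hC, hXC⟩ := exists_countable_coordinates b (Lp.aestronglyMeasurable X)
  have : Countable C := hC.to_subtype
  let x : C → Lp ℂ 2 μ := fun i => (innerSL ℂ (b i)).compLp X
  let y : C → Lp ℂ 2 μ := fun i => (innerSL ℂ (b i)).compLp Y
  have hbC : Orthonormal ℂ fun i : C => b i := b.orthonormal.comp _ Subtype.val_injective
  have hle : ∀ u : Finset C, ∑ i ∈ u, ‖x i‖ * ‖y i‖ ≤ ‖X‖ * ‖Y‖ := fun u => by
    refine (Real.sum_mul_le_sqrt_mul_sqrt u _ _).trans ?_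
    gcongr
    · exact Real.sqrt_le_iff.2 ⟨norm_nonneg _, sum_norm_sq_coordinate_le hbC X u⟩
    · exact Real.sqrt_le_iff.2 ⟨norm_nonneg _, sum_norm_sq_coordinate_le hbC Y u⟩
  have hnn : (0 : C → ℝ) ≤ fun i => ‖x i‖ * ‖y i‖ := fun i => by positivity
  have hsum : Summable fun i => ‖x i‖ * ‖y i‖ := summable_of_sum_le hnn hle
  refine (fourierBound_of_countable hsum fun s => ?_).mono (Real.tsum_le_of_sum_le hnn hle)
  have hmp : MeasurePreserving (s⁻¹ * ·) μ μ := measurePreserving_mul_left μ s⁻¹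
  have hx : ∀ᵐ t ∂μ, ∀ i : C, x i (s⁻¹ * t) = inner ℂ (b i) (X (s⁻¹ * t)) :=
    hmp.quasiMeasurePreserving.ae (ae_all_iff.2 fun i : C => (innerSL ℂ (b i)).coeFn_compLp X)
  have hy : ∀ᵐ t ∂μ, ∀ i : C, y i t = inner ℂ (b i) (Y t) :=
    ae_all_iff.2 fun i : C => (innerSL ℂ (b i)).coeFn_compLp Y
  have hXs := hmp.quasiMeasurePreserving.ae hXC
  let F : C → G → ℂ := fun i t => x i (s⁻¹ * t) * conj (y i t)
  have hF : ∀ i, F i =ᵐ[μ] fun t => (DomMulAct.mk s⁻¹ • x i : Lp ℂ 2 μ) t * conj (y i t) := by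
    intro i
    filter_upwards [DomMulAct.smul_Lp_ae_eq (DomMulAct.mk s⁻¹) (x i)] with t ht
    rw [ht]; simp [F]
  have hint : ∀ i, Integrable (F i) μ := fun i => by
    refine (L2.integrable_inner (𝕜 := ℂ) (y i) (DomMulAct.mk s⁻¹ • x i)).congr ?_
    filter_upwards [hF i] with t ht
    rw [ht]; simp
  have hbound : ∀ i, ∫ t, ‖F i t‖ ∂μ ≤ ‖x i‖ * ‖y i‖ := fun i => by
    refine le_trans (le_of_eq ?_) ((integral_norm_mul_le_Lp (DomMulAct.mk s⁻¹ • x i) (y i)).trans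
      (by simp))
    refine integral_congr_ae ?_
    filter_upwards [hF i] with t ht
    rw [ht]; simp
  have key := hasSum_integral_of_summable_integral_norm hint
    (hsum.of_nonneg_of_le (fun i => integral_nonneg fun t => norm_nonneg _) hbound)
  suffices h : ∫ t, inner ℂ (Y t) (X (s⁻¹ * t)) ∂μ = ∫ t, ∑' i, F i t ∂μ by rw [h]; exact key
  refine integral_congr_ae ?_
  filter_upwards [hx, hy, hXs] with t hx hy hX
  have h1 := b.hasSum_inner_mul_inner (Y t) (X (s⁻¹ * t))
  rw [← hasSum_subtype_iff_of_support_subset (s := C)] at h1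
  · rw [← h1.tsum_eq]
    refine tsum_congr fun i => ?_
    simp only [F, hx, hy, Function.comp_apply, inner_conj_symm, mul_comm]
  · intro i hi
    by_contra h
    exact hi (by simp [hX i h])

theorem fourierBound_vectorCoeff_of_memLp {X Y : G → E} (hX : MemLp X 2 μ) (hY : MemLp Y 2 μ) :
    FourierBound μ (fun s => ∫ t, inner ℂ (Y t) (X (s⁻¹ * t)) ∂μ)
      ((eLpNorm X 2 μ).toReal * (eLpNorm Y 2 μ).toReal) := by
  have h := fourierBound_vectorCoeff (hX.toLp X) (hY.toLp Y)
  rw [Lp.norm_toLp, Lp.norm_toLp] at h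
  convert h using 2 with s
  refine integral_congr_ae ?_
  filter_upwards [hY.coeFn_toLp, (measurePreserving_mul_left μ s⁻¹).quasiMeasurePreserving.ae
    hX.coeFn_toLp] with t h1 h2
  rw [h1, h2]

theorem integrable_inner_translate {F : Type*} [NormedAddCommGroup F] [InnerProductSpace ℂ F]
    {X Y : G → F} (hX : MemLp X 2 μ) (hY : MemLp Y 2 μ) (s : G) :
    Integrable (fun t => inner ℂ (Y t) (X (s⁻¹ * t))) μ := by
  have hXs : MemLp (fun t => X (s⁻¹ * t)) 2 μ :=
    hX.comp_measurePreserving (measurePreserving_mul_left μ s⁻¹)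
  refine (L2.integrable_inner (𝕜 := ℂ) (hY.toLp Y) (hXs.toLp _)).congr ?_
  filter_upwards [hY.coeFn_toLp, hXs.coeFn_toLp] with t h1 h2
  rw [h1, h2]

/-- The vector-valued coefficient of `ξ P` and `η Q`, for scalar weights `ξ` and `η`. Bounds on
`P` and `Q` are needed only where the weights do not vanish. -/
theorem fourierBound_weightedCoeff [μ.Regular] {ξ η : G → ℂ} (hξ : MemLp ξ 2 μ)
    (hη : MemLp η 2 μ) {P Q : G → E} (hP : Continuous P) (hQ : Continuous Q) {a b : ℝ}
    (ha : 0 ≤ a) (hb : 0 ≤ b)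
    (hPa : ∀ t, ξ t ≠ 0 → ‖P t‖ ≤ a) (hQb : ∀ t, η t ≠ 0 → ‖Q t‖ ≤ b) :
    FourierBound μ (fun s => ∫ t, inner ℂ (η t • Q t) (ξ (s⁻¹ * t) • P (s⁻¹ * t)) ∂μ)
      (a * (eLpNorm ξ 2 μ).toReal * (b * (eLpNorm η 2 μ).toReal)) :=
  (fourierBound_vectorCoeff_of_memLp (memLp_smul_of_bound hξ hP hPa)
    (memLp_smul_of_bound hη hQ hQb)).mono (by
      gcongr
      · exact eLpNorm_smul_toReal_le hξ ha hPa
      · exact eLpNorm_smul_toReal_le hη hb hQb)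

end VectorFourierBound

/-! ### Products, continuity and compact supports -/

section Translation

variable {G : Type*} [Group G] [TopologicalSpace G]

theorem hasCompactSupport_integral_translate [IsTopologicalGroup G] [MeasurableSpace G]
    {μ : Measure G} {φ ψ : G → ℂ} (hφ : HasCompactSupport φ)
    (hψ : HasCompactSupport ψ) :
    HasCompactSupport fun s => ∫ t, φ (s⁻¹ * t) * conj (ψ t) ∂μ := by
  refine HasCompactSupport.intro (hψ.isCompact.mul hφ.isCompact.inv) fun s hs => ?_
  refine integral_eq_zero_of_ae (Eventually.of_forall fun t => ?_)
  by_contra h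
  have h1 : φ (s⁻¹ * t) ≠ 0 := fun h' => h (by simp [h'])
  have h2 : ψ t ≠ 0 := fun h' => h (by simp [h'])
  exact hs ⟨t, subset_tsupport _ h2, (s⁻¹ * t)⁻¹,
    Set.inv_mem_inv.2 (subset_tsupport _ h1), by simp⟩

theorem continuous_mk_smul_Lp [IsTopologicalGroup G] [LocallyCompactSpace G]
    [MeasurableSpace G] [BorelSpace G] {μ : Measure G} [μ.IsHaarMeasure] [μ.Regular]
    (ξ : Lp ℂ 2 μ) : Continuous fun t : G => DomMulAct.mk t • ξ := by
  have : Fact ((2 : ℝ≥0∞) ≠ ∞) := ⟨by simp⟩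
  have h : Continuous fun t : Gᵈᵐᵃ => t • ξ := continuous_id.smul continuous_const
  exact h.comp DomMulAct.continuous_mk

theorem FourierBound.continuous [IsTopologicalGroup G] [LocallyCompactSpace G]
    [MeasurableSpace G] [BorelSpace G] {μ : Measure G} [μ.IsHaarMeasure] [μ.Regular]
    {f : G → ℂ} {c : ℝ} (hf : FourierBound μ f c) : Continuous f := by
  obtain ⟨ξ, η, ⟨hs, hf⟩, -⟩ := hf
  have : f = fun s => ∑' n, regularCoeff μ (ξ n) (η n) s := funext fun s => (hf s).tsum_eq.symm
  rw [this]
  refine continuous_tsum (fun n => ?_) hs fun n s => norm_regularCoeff_le _ _ s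
  have h : regularCoeff μ (ξ n) (η n) = fun s => inner ℂ (η n) (DomMulAct.mk s⁻¹ • ξ n) :=
    funext fun s => regularCoeff_eq_inner _ _ s
  rw [h]
  exact continuous_const.inner ((continuous_mk_smul_Lp _).comp continuous_inv)

theorem continuous_of_mem_fourierAlgebra [IsTopologicalGroup G] [LocallyCompactSpace G]
    [MeasurableSpace G] [BorelSpace G] {μ : Measure G} [μ.IsHaarMeasure] [μ.Regular]
    {f : G → ℂ} (hf : f ∈ fourierAlgebra μ) : Continuous f := by
  obtain ⟨c, hf⟩ := mem_fourierAlgebra_iff.1 hf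
  exact hf.continuous

theorem eventually_inv_mul_nhds [IsTopologicalGroup G] {p : G → Prop} (x : G)
    (h : ∀ᶠ s in 𝓝 (1 : G), p s) :
    ∀ᶠ s in 𝓝 x, p (x⁻¹ * s) := by
  have : Tendsto (fun s : G => x⁻¹ * s) (𝓝 x) (𝓝 1) := by
    simpa using (continuous_const_mul x⁻¹).tendsto x
  exact this h

end Translation

section Products

variable {G : Type*} [Group G] [TopologicalSpace G] [IsTopologicalGroup G]
  [LocallyCompactSpace G] [MeasurableSpace G] [BorelSpace G]
  {μ : Measure G} [μ.IsHaarMeasure] [μ.Regular]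
  {E : Type*} [NormedAddCommGroup E] [InnerProductSpace ℂ E]
  {f g u : G → ℂ} {c d : ℝ}

/-- The product of two coefficient functions is the vector-valued coefficient function of
`t ↦ ξ(t) λ(t⁻¹) ξ'` and `t ↦ η(t) λ(t⁻¹) η'`, so it lies in `A(G)`. -/
theorem fourierBound_regularCoeff_mul (ξ η ξ' η' : Lp ℂ 2 μ) :
    FourierBound μ (regularCoeff μ ξ η * regularCoeff μ ξ' η')
      (‖ξ‖ * ‖η‖ * (‖ξ'‖ * ‖η'‖)) := by
  have h := fourierBound_weightedCoeff (Lp.memLp ξ) (Lp.memLp η) (continuous_mk_smul_Lp ξ')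
    (continuous_mk_smul_Lp η') (norm_nonneg ξ') (norm_nonneg η') (fun t _ => by simp)
    (fun t _ => by simp)
  simp_rw [integral_inner_translates] at h
  refine h.mono (le_of_eq ?_)
  rw [← Lp.norm_def, ← Lp.norm_def]
  ring

/-- `A(G)` is closed under products, and its norm is submultiplicative. -/
theorem FourierBound.mul (hf : FourierBound μ f c) (hg : FourierBound μ g d) :
    FourierBound μ (f * g) (c * d) := by
  have hc := hf.nonneg
  obtain ⟨ξ, η, ⟨hs, hf⟩, hfc⟩ := hf
  obtain ⟨ξ', η', ⟨hs', hg⟩, hgd⟩ := hg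
  have hsum : Summable fun p : ℕ × ℕ => ‖ξ p.1‖ * ‖η p.1‖ * (‖ξ' p.2‖ * ‖η' p.2‖) :=
    hs.mul_of_nonneg hs' (fun n => by positivity) (fun n => by positivity)
  refine (FourierBound.of_hasSum (ι := ℕ × ℕ)
    (F := fun p => regularCoeff μ (ξ p.1) (η p.1) * regularCoeff μ (ξ' p.2) (η' p.2))
    (c := fun p => ‖ξ p.1‖ * ‖η p.1‖ * (‖ξ' p.2‖ * ‖η' p.2‖))
    (fun p => fourierBound_regularCoeff_mul _ _ _ _) hsum fun s => ?_).mono ?_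
  · have hs : Summable fun p : ℕ × ℕ => regularCoeff μ (ξ p.1) (η p.1) s *
        regularCoeff μ (ξ' p.2) (η' p.2) s := by
      refine hsum.of_norm_bounded fun p => ?_
      rw [norm_mul]
      exact mul_le_mul (norm_regularCoeff_le _ _ s) (norm_regularCoeff_le _ _ s)
        (norm_nonneg _) (by positivity)
    simp only [Pi.mul_apply]
    exact HasSum.mul (f := fun n => regularCoeff μ (ξ n) (η n) s)
      (g := fun n => regularCoeff μ (ξ' n) (η' n) s) (hf s) (hg s) hs
  · rw [(HasSum.mul (f := fun n => ‖ξ n‖ * ‖η n‖) (g := fun n => ‖ξ' n‖ * ‖η' n‖)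
      hs.hasSum hs'.hasSum hsum).tsum_eq]
    exact mul_le_mul hfc hgd (tsum_nonneg fun n => by positivity) hc

end Products

section Density

variable {G : Type*} [Group G] [TopologicalSpace G] [IsTopologicalGroup G]
  [MeasurableSpace G] [BorelSpace G]
  {μ : Measure G} [μ.IsHaarMeasure] [μ.Regular]
  {f : G → ℂ} {c : ℝ}

theorem exists_hasCompactSupport_near_regularCoeff (ξ η : Lp ℂ 2 μ) {ε : ℝ} (hε : 0 < ε) :
    ∃ g : G → ℂ, HasCompactSupport g ∧ (∃ d, FourierBound μ g d) ∧
      FourierBound μ (regularCoeff μ ξ η - g) ε := by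
  obtain ⟨δ, hδ, hδ1, hδε⟩ : ∃ δ : ℝ, 0 < δ ∧ δ ≤ 1 ∧ δ * (‖ξ‖ + 1 + ‖η‖) ≤ ε := by
    refine ⟨min 1 (ε / (‖ξ‖ + 1 + ‖η‖)), by positivity, min_le_left _ _, ?_⟩
    rw [← le_div_iff₀ (by positivity)]
    exact min_le_right _ _
  obtain ⟨φ, hφ, hφc, hξφ⟩ := exists_hasCompactSupport_Lp_near ξ hδ
  obtain ⟨ψ, hψ, hψc, hηψ⟩ := exists_hasCompactSupport_Lp_near η hδ
  refine ⟨regularCoeff μ (hφ.toLp φ) (hψ.toLp ψ), ?_, ⟨_, fourierBound_regularCoeff _ _⟩, ?_⟩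
  · rw [funext (regularCoeff_toLp hφ hψ)]
    exact hasCompactSupport_integral_translate hφc hψc
  · have h : regularCoeff μ ξ η - regularCoeff μ (hφ.toLp φ) (hψ.toLp ψ) =
        regularCoeff μ (ξ - hφ.toLp φ) η + regularCoeff μ (hφ.toLp φ) (η - hψ.toLp ψ) := by
      funext s
      simp [regularCoeff_eq_inner, inner_sub_left, inner_sub_right, DomMulAct.smul_Lp_sub]
    rw [h]
    refine ((fourierBound_regularCoeff _ _).add (fourierBound_regularCoeff _ _)).mono ?_
    have hφn : ‖hφ.toLp φ‖ ≤ ‖ξ‖ + 1 := by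
      have := norm_sub_norm_le (hφ.toLp φ) ξ
      rw [norm_sub_rev] at this
      linarith
    calc _ ≤ δ * ‖η‖ + (‖ξ‖ + 1) * δ := by gcongr
      _ ≤ ε := by linarith

/-- A sequence whose tail is summably small, and whose initial terms are each as small as desired,
has small sum. -/
theorem exists_initial_segment {c : ℕ → ℝ} (hc : Summable c) {ε : ℝ}
    (hε : 0 < ε) : ∃ (M : ℕ) (δ : ℝ), 0 < δ ∧
      Summable (fun n => if n < M then δ else c n) ∧
        ∑' n, (if n < M then δ else c n) ≤ ε := by
  obtain ⟨M, hM⟩ := ((tendsto_order.1 (tendsto_sum_nat_add c)).2 (ε / 2) (by positivity)).exists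
  refine ⟨M, ε / (2 * (M + 1)), by positivity, ?_⟩
  have hs : Summable (fun n => if n < M then ε / (2 * (M + 1)) else c n) := by
    rw [← summable_nat_add_iff M]
    simpa using (summable_nat_add_iff M).2 hc
  refine ⟨hs, ?_⟩
  rw [← hs.sum_add_tsum_nat_add M, Finset.sum_congr rfl fun n hn => if_pos (Finset.mem_range.1 hn)]
  have h1 : ∑ _n ∈ Finset.range M, ε / (2 * (M + 1 : ℝ)) ≤ ε / 2 := by
    rw [Finset.sum_const, Finset.card_range, nsmul_eq_mul]
    rw [mul_div_assoc', div_le_div_iff₀ (by positivity) (by positivity)]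
    nlinarith
  have h2 : ∑' n, (if n + M < M then ε / (2 * (M + 1)) else c (n + M)) ≤ ε / 2 := by
    simpa using hM.le
  linarith

/-- Compactly supported functions are dense in `A(G)`. -/
theorem FourierBound.exists_hasCompactSupport_near (hf : FourierBound μ f c) {ε : ℝ}
    (hε : 0 < ε) : ∃ g : G → ℂ, HasCompactSupport g ∧ g ∈ fourierAlgebra μ ∧
      FourierBound μ (f - g) ε := by
  obtain ⟨ξ, η, ⟨hs, hf⟩, -⟩ := hf
  obtain ⟨M, δ, hδ, hsum, hle⟩ := exists_initial_segment hs hε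
  choose g hgc hgA hg using fun n => exists_hasCompactSupport_near_regularCoeff (ξ n) (η n) hδ
  choose d hgd using hgA
  refine ⟨fun s => ∑ n ∈ Finset.range M, g n s, ?_, ?_, ?_⟩
  · simpa [Finset.sum_fn] using HasCompactSupport.finset_sum (s := Finset.range M) fun n _ => hgc n
  · refine (FourierBound.of_hasSum (ι := Finset.range M) (F := fun n => g n)
      (fun n => hgd n) (hasSum_fintype _).summable fun s => ?_).mem
    rw [← Finset.sum_coe_sort]
    exact hasSum_fintype _
  · refine (FourierBound.of_hasSum (ι := ℕ)
      (F := fun n => if n < M then regularCoeff μ (ξ n) (η n) - g n else regularCoeff μ (ξ n) (η n))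
      (fun n => ?_) hsum fun s => ?_).mono hle
    · split_ifs
      exacts [hg n, fourierBound_regularCoeff _ _]
    · have h := (hf s).sub (hasSum_sum_of_ne_finset_zero (f := fun n => if n < M then g n s else 0)
        (s := Finset.range M) fun n hn => if_neg (by simpa using hn))
      rw [Finset.sum_congr rfl fun n hn => if_pos (Finset.mem_range.1 hn)] at h
      refine h.congr_fun fun n => ?_
      split_ifs <;> simp

end Density

/-! ### Plateau functions and synthesis of points -/

section Bumps

variable {G : Type*} [Group G] [MeasurableSpace G]

/-- The function `s ↦ μ(V ∩ sO) / μ(V)`, which is the coefficient function of the indicator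
functions of `O` and `V`, normalised to take the value `1` as long as `V ⊆ sO`. -/
noncomputable def bumpFunction (μ : Measure G) (V O : Set G) : G → ℂ :=
  fun s => ((μ.real (V ∩ (s⁻¹ * ·) ⁻¹' O) / μ.real V : ℝ) : ℂ)

/-- Sets `V ⊆ O ⊆ N` for which `bumpFunction μ V O` has norm at most `2` in `A(G)`. -/
structure IsBumpPair [TopologicalSpace G] (μ : Measure G) (N V O : Set G) : Prop where
  isCompact : IsCompact V
  isOpen : IsOpen O
  subset : V ⊆ O
  subset_nhd : O ⊆ N
  pos : 0 < μ.real V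
  ne_top : μ O ≠ ∞
  le : μ.real O ≤ 4 * μ.real V

variable {μ : Measure G} {N V O : Set G}

theorem bumpFunction_nonneg (s : G) : ∃ r : ℝ, 0 ≤ r ∧ bumpFunction μ V O s = r :=
  ⟨_, by positivity, rfl⟩

variable [TopologicalSpace G]

theorem IsBumpPair.mono {X : Type*} [TopologicalSpace X] [MeasurableSpace X] {μ : Measure X}
    {N N' V O : Set X} (h : IsBumpPair μ N V O) (hN : N ⊆ N') : IsBumpPair μ N' V O :=
  { h with subset_nhd := h.subset_nhd.trans hN }

/-- The bump function lives on `V O⁻¹`. -/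
theorem IsBumpPair.mem_of_ne_zero (h : IsBumpPair μ N V O) {s : G}
    (hs : bumpFunction μ V O s ≠ 0) : s ∈ N * N⁻¹ := by
  have : (V ∩ (s⁻¹ * ·) ⁻¹' O).Nonempty := by
    by_contra h0
    rw [not_nonempty_iff_eq_empty] at h0
    exact hs (by simp [bumpFunction, h0])
  obtain ⟨t, htV, htO⟩ := this
  exact ⟨t, h.subset_nhd (h.subset htV), (s⁻¹ * t)⁻¹,
    Set.inv_mem_inv.2 (h.subset_nhd htO), by simp⟩

variable [IsTopologicalGroup G]

theorem IsBumpPair.eventually_eq_one (h : IsBumpPair μ N V O) :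
    ∀ᶠ s in 𝓝 (1 : G), bumpFunction μ V O s = 1 := by
  obtain ⟨W, hW, hWV⟩ := compact_open_separated_mul_left h.isCompact h.isOpen h.subset
  have hinv : ∀ᶠ s in 𝓝 (1 : G), s⁻¹ ∈ W := by
    have : Tendsto (fun s : G => s⁻¹) (𝓝 1) (𝓝 1) := by
      simpa using (continuous_inv (G := G)).tendsto 1
    exact this hW
  filter_upwards [hinv] with s hs
  have : V ∩ (s⁻¹ * ·) ⁻¹' O = V :=
    inter_eq_left.2 fun t ht => hWV (Set.mul_mem_mul hs ht)
  rw [bumpFunction, this, div_self h.pos.ne', Complex.ofReal_one]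

theorem exists_isBumpPair
    [LocallyCompactSpace G] [μ.IsHaarMeasure] [μ.Regular] (hN : N ∈ 𝓝 (1 : G)) :
    ∃ V O, IsBumpPair μ N V O := by
  obtain ⟨V, hV1, hVN, hV⟩ := local_compact_nhds (interior_mem_nhds.2 hN)
  have hpos : 0 < μ V := Measure.measure_pos_of_mem_nhds μ hV1
  have hlt : μ V < 4 * μ V := by
    calc μ V = 1 * μ V := (one_mul _).symm
      _ < 4 * μ V := (ENNReal.mul_lt_mul_iff_left hpos.ne' hV.measure_lt_top.ne).2 (by norm_num)
  obtain ⟨O, hVO, hO, hμO⟩ := V.exists_isOpen_lt_of_lt _ hlt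
  have htop : 4 * μ V ≠ ∞ := ENNReal.mul_ne_top (by simp) hV.measure_lt_top.ne
  refine ⟨V, O ∩ interior N, hV, hO.inter isOpen_interior, subset_inter hVO hVN,
    inter_subset_right.trans interior_subset, ENNReal.toReal_pos hpos.ne' hV.measure_lt_top.ne,
    ((measure_mono inter_subset_left).trans_lt (hμO.trans htop.lt_top)).ne, ?_⟩
  have h := ENNReal.toReal_mono htop
    ((measure_mono (inter_subset_left (t := interior N))).trans hμO.le)
  simpa [Measure.real] using h

variable [T2Space G] [BorelSpace G]

theorem IsBumpPair.bumpFunction_eq (h : IsBumpPair μ N V O) (s : G) :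
    bumpFunction μ V O s = ((μ.real V)⁻¹ : ℝ) * ∫ t, O.indicator (fun _ => (1 : ℂ)) (s⁻¹ * t) *
      conj (V.indicator (fun _ => (1 : ℂ)) t) ∂μ := by
  have hm : MeasurableSet (V ∩ (s⁻¹ * ·) ⁻¹' O) :=
    h.isCompact.measurableSet.inter (h.isOpen.preimage (by fun_prop)).measurableSet
  have hi : (fun t => O.indicator (fun _ => (1 : ℂ)) (s⁻¹ * t) *
      conj (V.indicator (fun _ => (1 : ℂ)) t)) =
      (V ∩ (s⁻¹ * ·) ⁻¹' O).indicator fun _ => (1 : ℂ) := by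
    funext t
    by_cases h1 : t ∈ V <;> by_cases h2 : s⁻¹ * t ∈ O <;> simp [h1, h2]
  rw [hi, integral_indicator_const _ hm, bumpFunction, div_eq_inv_mul]
  simp

variable [μ.IsHaarMeasure] [μ.Regular]
  {E : Type*} [NormedAddCommGroup E] [InnerProductSpace ℂ E] {u : G → ℂ} {c : ℝ}

/-- The weights `1_O` and `1_V` have norms `√μ(O) ≤ 2 √μ(V)` and `√μ(V)`, which the factor
`μ(V)⁻¹` compensates. -/
theorem IsBumpPair.fourierBound_weighted [CompleteSpace E] (h : IsBumpPair μ N V O) {P Q : G → E}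
    (hP : Continuous P) (hQ : Continuous Q) {a b : ℝ} (ha : 0 ≤ a) (hb : 0 ≤ b)
    (hPa : ∀ t ∈ N, ‖P t‖ ≤ a) (hQb : ∀ t ∈ N, ‖Q t‖ ≤ b) :
    FourierBound μ (fun s => ((μ.real V)⁻¹ : ℝ) *
      ∫ t, inner ℂ (V.indicator (fun _ => (1 : ℂ)) t • Q t)
        (O.indicator (fun _ => (1 : ℂ)) (s⁻¹ * t) • P (s⁻¹ * t)) ∂μ) (2 * (a * b)) := by
  have hVm := h.isCompact.measurableSet
  have key := (fourierBound_weightedCoeff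
    (memLp_indicator_one h.isOpen.measurableSet h.ne_top)
    (memLp_indicator_one hVm h.isCompact.measure_lt_top.ne) hP hQ ha hb
    (fun t ht => hPa t (h.subset_nhd (mem_of_indicator_ne_zero ht)))
    (fun t ht => hQb t (h.subset_nhd (h.subset (mem_of_indicator_ne_zero ht))))).smul
      ((μ.real V)⁻¹ : ℝ)
  rw [eLpNorm_indicator_one_toReal hVm, eLpNorm_indicator_one_toReal h.isOpen.measurableSet] at key
  refine key.mono ?_
  have hp := h.pos
  have h1 : √(μ.real O) ≤ 2 * √(μ.real V) := by
    rw [Real.sqrt_le_left (by positivity), mul_pow, Real.sq_sqrt hp.le]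
    linarith [h.le]
  rw [Complex.norm_real, Real.norm_of_nonneg (by positivity)]
  calc (μ.real V)⁻¹ * (a * √(μ.real O) * (b * √(μ.real V)))
      ≤ (μ.real V)⁻¹ * (a * (2 * √(μ.real V)) * (b * √(μ.real V))) := by gcongr
    _ = (μ.real V)⁻¹ * (√(μ.real V) * √(μ.real V)) * (2 * (a * b)) := by ring
    _ = 2 * (a * b) := by
      rw [Real.mul_self_sqrt hp.le, inv_mul_cancel₀ hp.ne', one_mul]

theorem IsBumpPair.fourierBound (h : IsBumpPair μ N V O) :
    FourierBound μ (bumpFunction μ V O) 2 := by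
  have := h.fourierBound_weighted (E := ℂ) (P := fun _ => 1) (Q := fun _ => 1) continuous_const
    continuous_const zero_le_one zero_le_one (by simp) (by simp)
  convert this using 1
  · funext s
    rw [h.bumpFunction_eq s]
    simp
  · norm_num

variable [LocallyCompactSpace G]

/-- If the bump function lives where `ξ` and `η` are moved by at most `δ`, then multiplying it with
the coefficient function of `ξ` and `η` is close to multiplying it with the value of that function
at `1`. -/
theorem IsBumpPair.fourierBound_regularCoeff_sub_mul (h : IsBumpPair μ N V O) (ξ η : Lp ℂ 2 μ)
    {δ : ℝ} (hδ : 0 ≤ δ) (hξ : ∀ t ∈ N, ‖DomMulAct.mk t • ξ - ξ‖ ≤ δ)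
    (hη : ∀ t ∈ N, ‖DomMulAct.mk t • η - η‖ ≤ δ) :
    FourierBound μ (fun s => (regularCoeff μ ξ η s - regularCoeff μ ξ η 1) * bumpFunction μ V O s)
      (2 * (δ * ‖η‖) + 2 * (‖ξ‖ * δ)) := by
  have hcξ := continuous_mk_smul_Lp ξ
  have hcη := continuous_mk_smul_Lp η
  have hdξ : Continuous fun t : G => DomMulAct.mk t • ξ - ξ := hcξ.sub continuous_const
  have hdη : Continuous fun t : G => DomMulAct.mk t • η - η := hcη.sub continuous_const
  have b1 := h.fourierBound_weighted hdξ hcη hδ (norm_nonneg η) hξ (fun t _ => by simp)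
  have b2 := h.fourierBound_weighted (P := fun _ => ξ) continuous_const hdη (norm_nonneg ξ) hδ
    (fun t _ => le_rfl) hη
  convert b1.add b2 using 1
  funext s
  have hO := memLp_indicator_one (μ := μ) h.isOpen.measurableSet h.ne_top
  have hV := memLp_indicator_one (μ := μ) h.isCompact.measurableSet h.isCompact.measure_lt_top.ne
  have m1 := memLp_smul_of_bound (a := ‖ξ‖ + ‖ξ‖) hO hdξ fun t _ =>
    (norm_sub_le _ _).trans (by simp)
  have m2 := memLp_smul_of_bound (a := ‖η‖) hV hcη fun t _ => by simp
  have m3 := memLp_smul_of_bound (a := ‖ξ‖) (P := fun _ => ξ) hO continuous_const fun t _ => le_rfl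
  have m4 := memLp_smul_of_bound (a := ‖η‖ + ‖η‖) hV hdη fun t _ =>
    (norm_sub_le _ _).trans (by simp)
  have m5 := memLp_smul_of_bound (a := ‖η‖) (P := fun _ => η) hV continuous_const fun t _ => le_rfl
  rw [Pi.add_apply, ← mul_add, ← integral_add (integrable_inner_translate m1 m2 s)
    (integrable_inner_translate m3 m4 s), h.bumpFunction_eq, sub_mul, mul_left_comm,
    mul_comm (regularCoeff μ ξ η s), ← integral_inner_translates, mul_left_comm, ← mul_sub]
  congr 1
  have h1 : regularCoeff μ ξ η 1 = inner ℂ η ξ := by simp [regularCoeff_eq_inner]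
  rw [h1, mul_comm, ← integral_mul_const, ← integral_sub]
  · congr with t
    simp only [inner_smul_left, inner_smul_right, inner_sub_left, inner_sub_right]
    ring
  · exact integrable_inner_translate (memLp_smul_of_bound (a := ‖ξ‖) hO hcξ fun t _ => by simp) m2 s
  · refine (integrable_inner_translate m3 m5 s).congr (Eventually.of_forall fun t => ?_)
    simp only [inner_smul_left, inner_smul_right]
    ring

/-- Points are sets of spectral synthesis for `A(G)`, with a bounded approximating family. -/
theorem FourierBound.exists_nhd_small (hu : FourierBound μ u c) {ε : ℝ} (hε : 0 < ε) :
    ∃ N ∈ 𝓝 (1 : G), ∀ V O, IsBumpPair μ N V O →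
      FourierBound μ (fun s => (u s - u 1) * bumpFunction μ V O s) ε := by
  obtain ⟨ξ, η, ⟨hs, hf⟩, -⟩ := hu
  obtain ⟨M, δ, hδ, hsum, hle⟩ := exists_initial_segment (hs.mul_left 4) hε
  have hN : ∀ n, ∃ N ∈ 𝓝 (1 : G), ∀ V O, IsBumpPair μ N V O → FourierBound μ (fun s =>
      (regularCoeff μ (ξ n) (η n) s - regularCoeff μ (ξ n) (η n) 1) * bumpFunction μ V O s) δ := by
    intro n
    obtain ⟨κ, hκ, hκδ⟩ : ∃ κ : ℝ, 0 < κ ∧ 2 * (κ * ‖η n‖) + 2 * (‖ξ n‖ * κ) ≤ δ := by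
      refine ⟨δ / (2 * (‖ξ n‖ + ‖η n‖ + 1)), by positivity, ?_⟩
      rw [show ∀ κ : ℝ, 2 * (κ * ‖η n‖) + 2 * (‖ξ n‖ * κ) = κ * (2 * (‖ξ n‖ + ‖η n‖)) by
        intro κ; ring, div_mul_eq_mul_div, div_le_iff₀ (by positivity)]
      exact mul_le_mul_of_nonneg_left (by linarith) hδ.le
    have hev : ∀ ζ : Lp ℂ 2 μ, ∀ᶠ t in 𝓝 (1 : G), ‖DomMulAct.mk t • ζ - ζ‖ ≤ κ := fun ζ => by
      have ht : Tendsto (fun t : G => ‖DomMulAct.mk t • ζ - ζ‖) (𝓝 1) (𝓝 0) := by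
        have := (((continuous_mk_smul_Lp ζ).sub continuous_const).norm.tendsto
          (f := fun t : G => ‖DomMulAct.mk t • ζ - ζ‖) 1)
        simpa using this
      exact (ht.eventually_lt_const hκ).mono fun t => le_of_lt
    exact ⟨_, (hev (ξ n)).and (hev (η n)), fun V O h =>
      (h.fourierBound_regularCoeff_sub_mul _ _ hκ.le (fun t ht => ht.1) fun t ht => ht.2).mono hκδ⟩
  choose N hN hbound using hN
  -- The first `M` terms are small near `1`; the others are bounded by `4 ‖ξ n‖ ‖η n‖` anyway.
  refine ⟨⋂ n ∈ Finset.range M, N n, (Finset.iInter_mem_sets _).2 fun n _ => hN n,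
    fun V O h => ?_⟩
  refine (FourierBound.of_hasSum (F := fun n s => (regularCoeff μ (ξ n) (η n) s -
    regularCoeff μ (ξ n) (η n) 1) * bumpFunction μ V O s) (fun n => ?_) hsum fun s => ?_).mono hle
  · split_ifs with hn
    · exact hbound n V O (h.mono (biInter_subset_of_mem (Finset.mem_range.2 hn)))
    · have h1 := (fourierBound_regularCoeff (ξ n) (η n)).mul h.fourierBound
      have h2 := h.fourierBound.smul (regularCoeff μ (ξ n) (η n) 1)
      convert (h1.sub h2).mono (d := 4 * (‖ξ n‖ * ‖η n‖)) _ using 1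
      · funext s
        simp [sub_mul]
      · linarith [norm_regularCoeff_le (ξ n) (η n) 1]
  · exact ((hf s).sub (hf 1)).mul_right _

end Bumps

/-! ### Ideals of the Fourier algebra -/

section Ideals

variable {G : Type*} [Group G] [TopologicalSpace G] [IsTopologicalGroup G]
  [LocallyCompactSpace G] [T2Space G] [MeasurableSpace G] [BorelSpace G]
  {μ : Measure G} [μ.IsHaarMeasure] [μ.Regular]
  {f u w : G → ℂ} {c r : ℝ}

/-- `A(G)` contains plateau functions at every point. -/
theorem exists_fourierBound_plateau (x : G) {U : Set G} (hU : U ∈ 𝓝 x) :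
    ∃ e : G → ℂ, FourierBound μ e 2 ∧ HasCompactSupport e ∧ (∀ᶠ s in 𝓝 x, e s = 1) ∧
      (∀ s, ∃ r : ℝ, 0 ≤ r ∧ e s = r) ∧ ∀ s, e s ≠ 0 → s ∈ U := by
  obtain ⟨K, hK, hxK⟩ := exists_compact_mem_nhds x
  have hcont : Tendsto (fun p : G × G => x * (p.1 * p.2⁻¹)) (𝓝 1 ×ˢ 𝓝 1) (𝓝 x) := by
    rw [← nhds_prod_eq]
    have h : Continuous fun p : G × G => x * (p.1 * p.2⁻¹) := by fun_prop
    simpa using h.tendsto (1, 1)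
  obtain ⟨N, hN, hNU⟩ := mem_prod_same_iff.1 (hcont (inter_mem hU hxK))
  obtain ⟨V, O, h⟩ := exists_isBumpPair (μ := μ) hN
  have hmem : ∀ s, bumpFunction μ V O (x⁻¹ * s) ≠ 0 → s ∈ U ∩ K := fun s hs => by
    obtain ⟨a, ha, b, hb, hab⟩ := h.mem_of_ne_zero hs
    have : x * (a * b⁻¹⁻¹) ∈ U ∩ K := hNU (show (a, b⁻¹) ∈ N ×ˢ N from ⟨ha, hb⟩)
    simpa [show a * b = x⁻¹ * s from hab] using this
  refine ⟨fun s => bumpFunction μ V O (x⁻¹ * s), h.fourierBound.translate x⁻¹,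
    HasCompactSupport.intro hK fun s hs => ?_, eventually_inv_mul_nhds x h.eventually_eq_one,
    fun s => bumpFunction_nonneg _, fun s hs => (hmem s hs).1⟩
  by_contra h0
  exact hs (hmem s h0).2

/-- Synthesis at a point, with a local unit `e`: near `x` the function `u` agrees in norm with the
constant `u x` up to `ε`, and the bound `2` on `e` does not depend on `ε`. -/
theorem FourierBound.exists_local_small (hu : FourierBound μ u c) (x : G) {ε : ℝ} (hε : 0 < ε) :
    ∃ e : G → ℂ, FourierBound μ e 2 ∧ (∀ᶠ s in 𝓝 x, e s = 1) ∧
      FourierBound μ (fun s => (u s - u x) * e s) ε := by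
  obtain ⟨N, hN, h⟩ := (hu.translate x).exists_nhd_small hε
  obtain ⟨V, O, hVO⟩ := exists_isBumpPair (μ := μ) hN
  refine ⟨fun s => bumpFunction μ V O (x⁻¹ * s), hVO.fourierBound.translate x⁻¹,
    eventually_inv_mul_nhds x hVO.eventually_eq_one, ?_⟩
  simpa using (h V O hVO).translate x⁻¹

theorem FourierBound.pow_succ (hw : FourierBound μ w r) (n : ℕ) :
    FourierBound μ (w ^ (n + 1)) (r ^ (n + 1)) := by
  induction n with
  | zero => simpa using hw
  | succ k ih => simpa only [_root_.pow_succ _ (k + 1)] using ih.mul hw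

/-- The Neumann series: an element of norm less than `1` has a quasi-inverse. -/
theorem FourierBound.exists_quasiInverse (hw : FourierBound μ w r) (hr : r < 1) :
    ∃ g ∈ fourierAlgebra μ, g = w + w * g := by
  have hlt : ∀ s, ‖w s‖ < 1 := fun s => (hw.norm_le s).trans_lt hr
  refine ⟨fun s => w s * (1 - w s)⁻¹, (FourierBound.of_hasSum (F := fun n => w ^ (n + 1))
    hw.pow_succ ?_ fun s => ?_).mem, ?_⟩
  · exact (summable_nat_add_iff 1).2 (summable_geometric_of_lt_one hw.nonneg hr)
  · simpa [_root_.pow_succ'] using (hasSum_geometric_of_norm_lt_one (hlt s)).mul_left (w s)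
  · funext s
    have h : 1 - w s ≠ 0 := fun h => by
      have := hlt s
      rw [← sub_eq_zero.1 h] at this
      simp at this
    simp only [Pi.add_apply, Pi.mul_apply]
    field_simp
    ring

variable {L : Submodule ℂ (G → ℂ)}

/-- An element of `A(G)` that does not vanish at `x` is invertible near `x`: by synthesis, it is
locally close to a constant. -/
theorem exists_mem_ideal_eventually_eq_one (hL : (L : Set (G → ℂ)) ⊆ fourierAlgebra μ)
    (hmul : ∀ a ∈ fourierAlgebra μ, ∀ u ∈ L, a * u ∈ L) (x : G) (hx : ∃ u ∈ L, u x ≠ 0) :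
    ∃ a ∈ L, ∀ᶠ s in 𝓝 x, a s = 1 := by
  obtain ⟨v, hvL, hvx⟩ := hx
  have huL : (v x)⁻¹ • v ∈ L := L.smul_mem _ hvL
  have hux : ((v x)⁻¹ • v) x = 1 := by simp [hvx]
  generalize (v x)⁻¹ • v = u at huL hux
  obtain ⟨c, hu⟩ := mem_fourierAlgebra_iff.1 (hL huL)
  obtain ⟨e, he, he1, hsmall⟩ := hu.exists_local_small x (show (0 : ℝ) < 1 / 2 by norm_num)
  obtain ⟨g, hg, hgw⟩ := hsmall.neg.exists_quasiInverse (by norm_num)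
  -- With `w = (1 - u) e`, the relation `g = w + w g` says `(1 - w) (1 + g) = 1`, and `1 - w = u`
  -- where `e = 1`.
  refine ⟨u + g * u, L.add_mem huL (hmul g hg u huL), ?_⟩
  filter_upwards [he1] with s hs
  have h := congrFun hgw s
  simp only [Pi.add_apply, Pi.mul_apply, Pi.neg_apply, hs, hux, mul_one] at h ⊢
  linear_combination h

/-- An ideal of `A(G)` without common zeros contains all compactly supported elements of `A(G)`. -/
theorem mem_ideal_of_hasCompactSupport (hL : (L : Set (G → ℂ)) ⊆ fourierAlgebra μ)
    (hmul : ∀ a ∈ fourierAlgebra μ, ∀ u ∈ L, a * u ∈ L) (hz : ∀ x, ∃ u ∈ L, u x ≠ 0)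
    (hf : f ∈ fourierAlgebra μ) (hfc : HasCompactSupport f) : f ∈ L := by
  obtain ⟨a, ha, ha1⟩ : ∃ a ∈ L, ∀ s ∈ tsupport f, a s = 1 := by
    refine IsCompact.induction_on (p := fun S => ∃ a ∈ L, ∀ s ∈ S, a s = 1) hfc
      ⟨0, L.zero_mem, by simp⟩ (fun S T hST ⟨a, ha, h⟩ => ⟨a, ha, fun s hs => h s (hST hs)⟩) ?_ ?_
    · rintro S T ⟨a, ha, h⟩ ⟨b, hb, h'⟩
      -- `1 - (1 - a) (1 - b)` equals `1` wherever `a` or `b` does.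
      refine ⟨a + b - a * b, L.sub_mem (L.add_mem ha hb) (hmul a (hL ha) b hb), ?_⟩
      rintro s (hs | hs)
      · simp [h s hs]
      · simp [h' s hs]
    · intro x _
      obtain ⟨a, ha, h⟩ := exists_mem_ideal_eventually_eq_one hL hmul x (hz x)
      exact ⟨{s | a s = 1}, mem_nhdsWithin_of_mem_nhds h, a, ha, fun s hs => hs⟩
  have h : f * a = f := by
    funext s
    by_cases hs : s ∈ tsupport f
    · simp [ha1 s hs]
    · simp [image_eq_zero_of_notMem_tsupport hs]
  exact h ▸ hmul f hf a ha

end Ideals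

section Series

variable {G : Type*} [Group G] [MeasurableSpace G] {μ : Measure G}
  {I : Submodule ℂ (G → ℂ)} {f : G → ℂ}

theorem ellOneAct_single {Γ : Type*} [Group Γ] [DecidableEq Γ] (s : Γ)
    (u : Γ → ℂ) (t : Γ) :
    ellOneAct (lp.single 1 s (1 : ℂ)) u t = u (s⁻¹ * t) := by
  unfold ellOneAct
  rw [tsum_eq_single s]
  · simp
  · intro r hr
    simp [hr]

theorem groupConv_eq_integral_translate (u v : G → ℂ) :
    groupConv μ u v = fun s =>
      ∫ t, (fun r => v r⁻¹) (s⁻¹ * t) * conj ((fun r => conj (u r)) t) ∂μ := by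
  funext s
  refine integral_congr_ae (Eventually.of_forall fun t => ?_)
  simp [mul_comm]

/-- Only point masses in `ℓ¹(G)` are needed to form elements of `S₀(G)`. -/
theorem mem_segalAlgebra_of_hasSum {ι : Type*} [Countable ι] {s : ι → G} {u : ι → G → ℂ}
    (hu : ∀ i, u i ∈ I) (hs : Summable fun i => fourierNorm μ (u i))
    (hf : ∀ t, HasSum (fun i => u i ((s i)⁻¹ * t)) (f t)) : f ∈ segalAlgebra μ I := by
  classical
  obtain ⟨e, he⟩ := exists_injective_nat ι
  let x : ι → lp (fun _ : G => ℂ) 1 := fun i => lp.single 1 (s i) 1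
  have key : ∀ {β : Type _} [AddCommMonoid β] (F : lp (fun _ : G => ℂ) 1 → (G → ℂ) → β),
      F 0 0 = 0 → (fun n => F (Function.extend e x 0 n) (Function.extend e u 0 n)) =
        Function.extend e (fun i => F (x i) (u i)) 0 := by
    intro β _ F hF
    funext n
    by_cases hn : ∃ i, e i = n
    · obtain ⟨i, rfl⟩ := hn
      simp [he.extend_apply]
    · simp [Function.extend_apply' _ _ _ hn, hF]
  refine ⟨Function.extend e x 0, Function.extend e u 0, fun n => ?_, ?_, fun t => ?_⟩
  · by_cases hn : ∃ i, e i = n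
    · obtain ⟨i, rfl⟩ := hn
      simpa [he.extend_apply] using hu i
    · simp [Function.extend_apply' _ _ _ hn]
  · rw [key (fun a b => ‖a‖ * fourierNorm μ b) (by simp)]
    have hx : ∀ i, ‖x i‖ = 1 := fun i => by
      rw [lp.norm_single (by simp)]
      simp
    simpa [hx] using ((hasSum_extend_zero he).2 hs.hasSum).summable
  · rw [key (fun a b => ellOneAct a b t) (by simp [ellOneAct]), hasSum_extend_zero he]
    simpa only [x, ellOneAct_single] using hf t

variable [TopologicalSpace G]

theorem exists_mem_segalAlgebra_ne_zero (hI : IsCompactlySupportedIdeal μ I) (x : G) :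
    ∃ f ∈ segalAlgebra μ I, f x ≠ 0 := by
  obtain ⟨u, hu, hu0⟩ := I.ne_bot_iff.1 hI.ne_bot
  obtain ⟨y, hy⟩ := Function.ne_iff.1 hu0
  refine ⟨fun t => u ((x * y⁻¹)⁻¹ * t), mem_segalAlgebra_of_hasSum (ι := Unit)
    (s := fun _ => x * y⁻¹) (u := fun _ => u) (fun _ => hu) (hasSum_fintype _).summable
    fun t => by simp, by simpa using hy⟩

variable [IsTopologicalGroup G] [BorelSpace G] [μ.IsMulLeftInvariant]

/-- An element of `S₀(G)` is a series of translates of elements of the ideal with summable norms. -/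
theorem exists_hasSum_of_mem_segalAlgebra (hI : IsCompactlySupportedIdeal μ I)
    (hf : f ∈ segalAlgebra μ I) : ∃ (D : Set (ℕ × G)) (u : ℕ × G → G → ℂ) (c : ℕ × G → ℝ),
      D.Countable ∧ (∀ p, u p ∈ I) ∧ (∀ p, FourierBound μ (u p) (c p)) ∧
        Summable (fun p : D => c p) ∧
        ∀ t, HasSum (fun p : D => u p (p.1.2⁻¹ * t)) (f t) := by
  obtain ⟨x, u, hu, hs, hf⟩ := hf
  obtain ⟨c, hc, hcs⟩ : ∃ c : ℕ → ℝ, (∀ n, FourierBound μ (u n) (c n)) ∧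
      Summable fun n => ‖x n‖ * c n := by
    -- The infimum defining the norm need not be attained, so a summable error is added.
    refine ⟨fun n => fourierNorm μ (u n) + (1 / 2) ^ n / (1 + ‖x n‖), fun n =>
      fourierBound_of_fourierNorm_lt (hI.subset (hu n)) (lt_add_of_pos_right _ (by positivity)), ?_⟩
    have h2 : Summable fun n => ‖x n‖ * ((1 / 2) ^ n / (1 + ‖x n‖)) := by
      refine Summable.of_nonneg_of_le (fun n => by positivity) (fun n => ?_)
        summable_geometric_two
      rw [mul_div_assoc', div_le_iff₀ (by positivity), mul_comm]
      exact mul_le_mul_of_nonneg_left (by linarith) (by positivity)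
    simpa only [mul_add] using hs.add h2
  have hx : ∀ n, HasSum (fun s => ‖x n s‖) ‖x n‖ := fun n => by
    simpa using lp.hasSum_norm (p := 1) (by simp) (x n)
  have hsum : Summable fun p : ℕ × G => ‖x p.1 p.2‖ * c p.1 := by
    refine (summable_prod_of_nonneg fun p => mul_nonneg (norm_nonneg _) (hc _).nonneg).2
      ⟨fun n => (hx n).summable.mul_right (c n), ?_⟩
    refine hcs.congr fun n => ?_
    dsimp only
    rw [tsum_mul_right, (hx n).tsum_eq]
  refine ⟨Function.support fun p : ℕ × G => ‖x p.1 p.2‖ * c p.1, fun p => x p.1 p.2 • u p.1,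
    fun p => ‖x p.1 p.2‖ * c p.1, hsum.countable_support,
    fun p => I.smul_mem _ (hu _), fun p => (hc p.1).smul (x p.1 p.2), hsum.subtype _, fun t => ?_⟩
  have hle : ∀ p : ℕ × G, ‖x p.1 p.2 * u p.1 (p.2⁻¹ * t)‖ ≤ ‖x p.1 p.2‖ * c p.1 := fun p => by
    rw [norm_mul]
    exact mul_le_mul_of_nonneg_left ((hc _).norm_le _) (norm_nonneg _)
  have h1 : Summable fun p : ℕ × G => x p.1 p.2 * u p.1 (p.2⁻¹ * t) := hsum.of_norm_bounded hle
  have h2 := h1.hasSum.prod_fiberwise fun n => (h1.prod_factor n).hasSum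
  have h3 := (hf t).unique h2
  have h4 := h1.hasSum
  rw [← h3] at h4
  refine (hasSum_subtype_iff_of_support_subset fun p hp => ?_).2 h4
  intro h0
  exact hp (norm_le_zero_iff.1 ((hle p).trans_eq h0))

theorem segalAlgebra_subset_fourierAlgebra (hI : IsCompactlySupportedIdeal μ I) :
    (segalAlgebra μ I : Set (G → ℂ)) ⊆ fourierAlgebra μ := by
  intro f hf
  obtain ⟨D, u, c, hD, -, hc, hs, hf⟩ := exists_hasSum_of_mem_segalAlgebra hI hf
  have := hD.to_subtype
  exact (FourierBound.of_hasSum (F := fun (p : D) t => u p (p.1.2⁻¹ * t))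
    (fun p => (hc p).translate _) hs hf).mem

end Series

section Segal

variable {G : Type*} [Group G] [TopologicalSpace G] [IsTopologicalGroup G]
  [LocallyCompactSpace G] [T2Space G] [MeasurableSpace G] [BorelSpace G]
  {μ : Measure G} [μ.IsHaarMeasure] [μ.Regular]
  {I : Submodule ℂ (G → ℂ)} {f : G → ℂ}

/-- `S₀(G)` is an ideal of `A(G)`: multiplying a translate `s·u` by `a` gives `s·((s⁻¹·a) u)`, and
`(s⁻¹·a) u` lies in the given ideal. -/
theorem mul_mem_segalAlgebra (hI : IsCompactlySupportedIdeal μ I) (a : G → ℂ)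
    (ha : a ∈ fourierAlgebra μ) (f : G → ℂ) (hf : f ∈ segalAlgebra μ I) :
    a * f ∈ segalAlgebra μ I := by
  obtain ⟨D, u, c, hD, hu, hc, hs, hf⟩ := exists_hasSum_of_mem_segalAlgebra hI hf
  obtain ⟨d, ha⟩ := mem_fourierAlgebra_iff.1 ha
  have := hD.to_subtype
  refine mem_segalAlgebra_of_hasSum (s := fun p : D => p.1.2)
    (u := fun p => (fun t => a (p.1.2 * t)) * u p)
    (fun p => hI.mul_mem _ (ha.translate _).mem _ (hu p)) ?_ fun t => ?_
  · exact (hs.mul_left d).of_nonneg_of_le (fun p => fourierNorm_nonneg _)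
      fun p => ((ha.translate _).mul (hc p)).fourierNorm_le
  · simpa using (hf t).mul_left (a t)

/-- All compactly supported elements of `A(G)` lie in `S₀(G)`, whatever the ideal it is built
from. -/
theorem mem_segalAlgebra_of_hasCompactSupport (hI : IsCompactlySupportedIdeal μ I)
    (hf : f ∈ fourierAlgebra μ) (hfc : HasCompactSupport f) : f ∈ segalAlgebra μ I :=
  mem_ideal_of_hasCompactSupport (segalAlgebra_subset_fourierAlgebra hI)
    (mul_mem_segalAlgebra hI) (exists_mem_segalAlgebra_ne_zero hI) hf hfc

end Segal

/-! ### Multiplicative functionals and composition operators -/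

section Characters

variable {G : Type*} [Group G] [TopologicalSpace G] [IsTopologicalGroup G]
  [LocallyCompactSpace G] [T2Space G] [MeasurableSpace G] [BorelSpace G]
  {μ : Measure G} [μ.IsHaarMeasure] [μ.Regular] {I : Submodule ℂ (G → ℂ)}

/-- The spectrum of `S₀(G)` is `G`: every non-zero multiplicative functional, continuous or not, is
the evaluation at a point. If its kernel, which is an ideal of `A(G)`, had no common zero, it would
contain all compactly supported elements of `A(G)`; a Neumann series excludes this. -/
theorem exists_eq_eval_of_multiplicative (hI : IsCompactlySupportedIdeal μ I)
    (χ : segalAlgebra μ I →ₗ[ℂ] ℂ)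
    (hχ : ∀ u v w : segalAlgebra μ I, (w : G → ℂ) = (u : G → ℂ) * (v : G → ℂ) → χ w = χ u * χ v)
    (hne : ∃ v, χ v ≠ 0) : ∃ x : G, ∀ u : segalAlgebra μ I, χ u = (u : G → ℂ) x := by
  obtain ⟨v, hv⟩ : ∃ v, χ v = 1 := by
    obtain ⟨v, hv⟩ := hne
    exact ⟨(χ v)⁻¹ • v, by simp [hv]⟩
  have hSA := segalAlgebra_subset_fourierAlgebra hI
  have hS := mul_mem_segalAlgebra hI
  let act : ∀ a ∈ fourierAlgebra μ, segalAlgebra μ I → segalAlgebra μ I :=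
    fun a ha u => ⟨a * u, hS a ha u u.2⟩
  -- `a ↦ χ (a v)` extends `χ` to all of `A(G)`.
  have hact : ∀ a ha u, χ (act a ha u) = χ u * χ (act a ha v) := fun a ha u => by
    have h1 := hχ (act a ha u) v (act a ha (act u (hSA u.2) v)) (by simp [act, mul_assoc])
    have h2 := hχ u (act a ha v) (act a ha (act u (hSA u.2) v)) (by simp [act, mul_left_comm])
    rw [hv, mul_one] at h1
    rw [← h1, h2]
  let L : Submodule ℂ (G → ℂ) := (LinearMap.ker χ).map (segalAlgebra μ I).subtype
  have hmemL : ∀ u : segalAlgebra μ I, (u : G → ℂ) ∈ L ↔ χ u = 0 := fun u => by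
    simp [L, Submodule.mem_map]
  have hLS : ∀ u ∈ L, u ∈ segalAlgebra μ I := by
    rintro _ ⟨u, -, rfl⟩
    exact u.2
  have hLA : (L : Set (G → ℂ)) ⊆ fourierAlgebra μ := fun u hu => hSA (hLS u hu)
  have hLmul : ∀ a ∈ fourierAlgebra μ, ∀ u ∈ L, a * u ∈ L := by
    intro a ha u hu
    have h0 : χ ⟨u, hLS u hu⟩ = 0 := (hmemL _).1 hu
    refine (hmemL (act a ha ⟨u, hLS u hu⟩)).2 ?_
    rw [hact a ha, h0, zero_mul]
  by_cases hz : ∀ x, ∃ u ∈ L, u x ≠ 0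
  · exfalso
    obtain ⟨c, hvc⟩ := mem_fourierAlgebra_iff.1 (hSA v.2)
    obtain ⟨f, hfc, hf, hvf⟩ := hvc.exists_hasCompactSupport_near
      (show (0 : ℝ) < 1 / 2 by norm_num)
    obtain ⟨g, hg, hgw⟩ := hvf.exists_quasiInverse (by norm_num)
    have hfL := mem_ideal_of_hasCompactSupport hLA hLmul hz hf hfc
    have hfS := hLS f hfL
    have hχf : χ ⟨f, hfS⟩ = 0 := (hmemL ⟨f, hfS⟩).1 hfL
    -- `χ` takes the value `1` on `w = v - f`, but `g = w + w g`, so `χ (g v) = 1 + χ (g v)`.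
    let w : segalAlgebra μ I := v - ⟨f, hfS⟩
    have hw : χ w = 1 := by simp [w, hv, hχf]
    have hgw' : act g hg v = act w (hSA w.2) v + act g hg (act w (hSA w.2) v) := by
      ext1
      change g * (v : G → ℂ) = ((v : G → ℂ) - f) * v + g * (((v : G → ℂ) - f) * v)
      conv_lhs => rw [hgw]
      ring
    have h2 := congrArg χ hgw'
    have h3 : χ (act w (hSA w.2) v) = 1 := by
      rw [hχ w v _ rfl, hw, hv, one_mul]
    rw [map_add, hact g hg (act w (hSA w.2) v), h3, one_mul] at h2
    simp at h2
  · push Not at hz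
    obtain ⟨x, hx⟩ := hz
    have hval : ∀ u : segalAlgebra μ I, (u : G → ℂ) x = χ u * (v : G → ℂ) x := fun u => by
      have h := hx _ ((hmemL (u - χ u • v)).2 (by simp [hv]))
      simpa [sub_eq_zero] using h
    have hvx : (v : G → ℂ) x ≠ 0 := fun h0 => by
      obtain ⟨u, hu, hux⟩ := exists_mem_segalAlgebra_ne_zero hI x
      exact hux (by simpa [h0] using hval ⟨u, hu⟩)
    have h1 : (v : G → ℂ) x = 1 := by
      have h := hval (act v (hSA v.2) v)
      rw [hχ v v _ rfl, hv] at h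
      simpa [act, hvx] using h
    exact ⟨x, fun u => by rw [hval u, h1, mul_one]⟩

theorem exists_mem_segalAlgebra_separating (hI : IsCompactlySupportedIdeal μ I) {x y : G}
    (h : x ≠ y) : ∃ u : segalAlgebra μ I, (u : G → ℂ) x ≠ (u : G → ℂ) y := by
  obtain ⟨e, he, hec, he1, -, heU⟩ := exists_fourierBound_plateau (μ := μ) x
    (isOpen_compl_singleton.mem_nhds (mem_compl_singleton_iff.2 h))
  refine ⟨⟨e, mem_segalAlgebra_of_hasCompactSupport hI he.mem hec⟩, ?_⟩
  have h0 : e y = 0 := by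
    by_contra h0
    exact heU y h0 rfl
  simp [he1.self_of_nhds, h0]

/-- The convolution `u ∗ v` is the coefficient function of `r ↦ v(r⁻¹)` and `conj u`, hence it
lies in `A(G)`, and it has compact support. -/
theorem groupConv_mem_segalAlgebra (hI : IsCompactlySupportedIdeal μ I) {u v : G → ℂ}
    (hu : Continuous u) (huc : HasCompactSupport u) (hv : Continuous v)
    (hvc : HasCompactSupport v) : groupConv μ u v ∈ segalAlgebra μ I := by
  have hvc' : HasCompactSupport fun r => v r⁻¹ := hvc.comp_homeomorph (Homeomorph.inv G)
  have huc' : HasCompactSupport fun r => conj (u r) := huc.comp_left (map_zero _)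
  have hvL : MemLp (fun r => v r⁻¹) 2 μ :=
    (hv.comp continuous_inv).memLp_of_hasCompactSupport hvc'
  have huL : MemLp (fun r => conj (u r)) 2 μ :=
    (Complex.continuous_conj.comp hu).memLp_of_hasCompactSupport huc'
  have h : groupConv μ u v = regularCoeff μ (hvL.toLp _) (huL.toLp _) := by
    funext s
    rw [groupConv_eq_integral_translate, regularCoeff_toLp hvL huL s]
  have hc : HasCompactSupport (groupConv μ u v) := by
    have hc := hasCompactSupport_integral_translate (μ := μ) hvc' huc'
    rwa [h, funext (regularCoeff_toLp hvL huL)]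
  refine mem_segalAlgebra_of_hasCompactSupport hI ?_ hc
  rw [h]
  exact (fourierBound_regularCoeff (hvL.toLp _) (huL.toLp _)).mem

/-- A homeomorphism inducing a homomorphism for the convolution products is compatible with
quotients: otherwise there are plateau functions `u` at `α k` and `v` at `(α k)⁻¹ α h` with
`u ∗ v` positive at `α h`, while the integrand of the convolution of their images vanishes. -/
theorem map_inv_mul_of_groupConv {G H : Type*}
    [Group G] [TopologicalSpace G] [IsTopologicalGroup G] [LocallyCompactSpace G] [T2Space G]
    [MeasurableSpace G] [BorelSpace G] [Group H] [TopologicalSpace H] [IsTopologicalGroup H]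
    [MeasurableSpace H] {μ : Measure G} [μ.IsHaarMeasure] [μ.Regular] {ν : Measure H}
    {I : Submodule ℂ (G → ℂ)} {J : Submodule ℂ (H → ℂ)}
    (hI : IsCompactlySupportedIdeal μ I) (α : H ≃ₜ G)
    (Φ : segalAlgebra μ I → segalAlgebra ν J)
    (hΦ : ∀ (u : segalAlgebra μ I) (h : H), (Φ u : H → ℂ) h = (u : G → ℂ) (α h))
    (hconv : ∀ u v w : segalAlgebra μ I,
      (w : G → ℂ) = groupConv μ (u : G → ℂ) (v : G → ℂ) →
        (Φ w : H → ℂ) = groupConv ν (Φ u : H → ℂ) (Φ v : H → ℂ)) (k h : H) :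
    α (k⁻¹ * h) = (α k)⁻¹ * α h := by
  by_contra hne
  obtain ⟨U, U', hU, hU', hpU, hqU', hdisj⟩ := t2_separation hne
  obtain ⟨v, hv, hvc, hv1, hv0, hvU⟩ :=
    exists_fourierBound_plateau (μ := μ) ((α k)⁻¹ * α h) (hU'.mem_nhds hqU')
  have hN : ∀ᶠ y in 𝓝 (α k), α ((α.symm y)⁻¹ * h) ∈ U := by
    have hc : Continuous fun y => α ((α.symm y)⁻¹ * h) := by fun_prop
    exact hc.continuousAt.eventually (hU.mem_nhds (by simpa using hpU))
  obtain ⟨u, hu, huc, hu1, hu0, huN⟩ := exists_fourierBound_plateau (μ := μ) (α k) hN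
  let u' : segalAlgebra μ I := ⟨u, mem_segalAlgebra_of_hasCompactSupport hI hu.mem huc⟩
  let v' : segalAlgebra μ I := ⟨v, mem_segalAlgebra_of_hasCompactSupport hI hv.mem hvc⟩
  let w : segalAlgebra μ I := ⟨groupConv μ u v,
    groupConv_mem_segalAlgebra hI hu.continuous huc hv.continuous hvc⟩
  have h1 := congrFun (hconv u' v' w rfl) h
  have hzero : groupConv ν (Φ u' : H → ℂ) (Φ v' : H → ℂ) h = 0 := by
    refine integral_eq_zero_of_ae (Eventually.of_forall fun r => ?_)
    dsimp only
    rw [hΦ, hΦ]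
    by_contra hr
    have hur : u (α r) ≠ 0 := fun h0 => hr (by simp [u', h0])
    have hvr : v (α (r⁻¹ * h)) ≠ 0 := fun h0 => hr (by simp [v', h0])
    have hmem : α (r⁻¹ * h) ∈ U := by simpa using huN _ hur
    exact Set.disjoint_left.1 hdisj hmem (hvU _ hvr)
  rw [hzero, hΦ] at h1
  choose ρ hρ hρu using hu0
  choose σ hσ hσv using hv0
  have hint : groupConv μ u v (α h) = ((∫ y, ρ y * σ (y⁻¹ * α h) ∂μ : ℝ) : ℂ) := by
    rw [← integral_complex_ofReal]
    exact integral_congr_ae (Eventually.of_forall fun y => by simp [hρu, hσv])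
  have hρ' : ρ = fun y => (u y).re := funext fun y => by simp [hρu]
  have hσ' : σ = fun y => (v y).re := funext fun y => by simp [hσv]
  have hcont : Continuous fun y => ρ y * σ (y⁻¹ * α h) := by
    have := hu.continuous
    have := hv.continuous
    rw [hρ', hσ']
    fun_prop
  have hcs : HasCompactSupport fun y => ρ y * σ (y⁻¹ * α h) := by
    refine HasCompactSupport.mul_right ?_
    rw [hρ']
    exact huc.comp_left (g := Complex.re) rfl
  have hpos : 0 < ∫ y, ρ y * σ (y⁻¹ * α h) ∂μ := by
    refine hcont.integral_pos_of_hasCompactSupport_nonneg_nonzero (x := α k) hcs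
      (fun y => mul_nonneg (hρ _) (hσ _)) ?_
    have e1 : ρ (α k) = 1 := by simp [hρ', hu1.self_of_nhds]
    have e2 : σ ((α k)⁻¹ * α h) = 1 := by simp [hσ', hv1.self_of_nhds]
    simp [e1, e2]
  refine hpos.ne' ?_
  have h2 : groupConv μ u v (α h) = 0 := h1
  rw [hint] at h2
  exact_mod_cast h2

end Characters

section Main

variable {G H : Type*}
  [Group G] [TopologicalSpace G] [IsTopologicalGroup G] [LocallyCompactSpace G] [T2Space G]
  [MeasurableSpace G] [BorelSpace G]
  [Group H] [TopologicalSpace H] [IsTopologicalGroup H] [LocallyCompactSpace H]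
  [MeasurableSpace H] [BorelSpace H]
  {μ : Measure G} [μ.IsHaarMeasure] [μ.Regular] {ν : Measure H} [ν.IsHaarMeasure] [ν.Regular]
  {I : Submodule ℂ (G → ℂ)} {J : Submodule ℂ (H → ℂ)}

/-- Isomorphisms for the pointwise products are composition operators. -/
theorem exists_continuous_eq_comp (hI : IsCompactlySupportedIdeal μ I)
    (hJ : IsCompactlySupportedIdeal ν J) (Φ : segalAlgebra μ I ≃ₗ[ℂ] segalAlgebra ν J)
    (hmul : ∀ u v w : segalAlgebra μ I, (w : G → ℂ) = (u : G → ℂ) * (v : G → ℂ) →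
      (Φ w : H → ℂ) = (Φ u : H → ℂ) * (Φ v : H → ℂ)) :
    ∃ α : H → G, Continuous α ∧ ∀ (u : segalAlgebra μ I) (h : H),
      (Φ u : H → ℂ) h = (u : G → ℂ) (α h) := by
  have key : ∀ h : H, ∃ x : G, ∀ u : segalAlgebra μ I, (Φ u : H → ℂ) h = (u : G → ℂ) x := by
    intro h
    refine exists_eq_eval_of_multiplicative hI
      (LinearMap.proj h ∘ₗ (segalAlgebra ν J).subtype ∘ₗ Φ.toLinearMap)
      (fun u v w hw => by simpa using congrFun (hmul u v w hw) h) ?_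
    obtain ⟨f, hf, hfh⟩ := exists_mem_segalAlgebra_ne_zero hJ h
    exact ⟨Φ.symm ⟨f, hf⟩, by simpa using hfh⟩
  choose α hα using key
  refine ⟨α, continuous_iff_continuousAt.2 fun h U hU => ?_, fun u h => hα h u⟩
  obtain ⟨e, he, hec, he1, -, heU⟩ := exists_fourierBound_plateau (μ := μ) (α h) hU
  let u : segalAlgebra μ I := ⟨e, mem_segalAlgebra_of_hasCompactSupport hI he.mem hec⟩
  have hcont : Continuous (Φ u : H → ℂ) :=
    continuous_of_mem_fourierAlgebra (segalAlgebra_subset_fourierAlgebra hJ (Φ u).2)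
  have hh : (Φ u : H → ℂ) h ≠ 0 := by
    rw [hα h u]
    simp [u, he1.self_of_nhds]
  change ∀ᶠ k in 𝓝 h, α k ∈ U
  filter_upwards [hcont.continuousAt.eventually_ne hh] with k hk
  exact heU _ (by rwa [hα k u] at hk)

theorem comp_eq_id_of_forall_apply_eq (hI : IsCompactlySupportedIdeal μ I) {γ : G → G}
    (h : ∀ (u : segalAlgebra μ I) x, (u : G → ℂ) (γ x) = (u : G → ℂ) x) (x : G) : γ x = x := by
  by_contra hne
  obtain ⟨u, hu⟩ := exists_mem_segalAlgebra_separating hI hne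
  exact hu (h u x)

end Main

theorem mainTheorem1 {G H : Type*}
    [Group G] [TopologicalSpace G] [IsTopologicalGroup G] [LocallyCompactSpace G] [T2Space G]
    [MeasurableSpace G] [BorelSpace G]
    [Group H] [TopologicalSpace H] [IsTopologicalGroup H] [LocallyCompactSpace H] [T2Space H]
    [MeasurableSpace H] [BorelSpace H]
    (μ : Measure G) [μ.IsHaarMeasure] [μ.Regular]
    (ν : Measure H) [ν.IsHaarMeasure] [ν.Regular]
    (I : Submodule ℂ (G → ℂ)) (hI : IsCompactlySupportedIdeal μ I)
    (J : Submodule ℂ (H → ℂ)) (hJ : IsCompactlySupportedIdeal ν J)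
    (Φ : segalAlgebra μ I ≃ₗ[ℂ] segalAlgebra ν J)
    (hmul : ∀ u v w : segalAlgebra μ I,
      (w : G → ℂ) = (u : G → ℂ) * (v : G → ℂ) →
        (Φ w : H → ℂ) = (Φ u : H → ℂ) * (Φ v : H → ℂ))
    (hconv : ∀ u v w : segalAlgebra μ I,
      (w : G → ℂ) = groupConv μ (u : G → ℂ) (v : G → ℂ) →
        (Φ w : H → ℂ) = groupConv ν (Φ u : H → ℂ) (Φ v : H → ℂ)) :
    ∃ α : H ≃ₜ* G, ∀ u : segalAlgebra μ I, (Φ u : H → ℂ) = (u : G → ℂ) ∘ α := by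
  have hmul' : ∀ u v w : segalAlgebra ν J, (w : H → ℂ) = (u : H → ℂ) * (v : H → ℂ) →
      (Φ.symm w : G → ℂ) = (Φ.symm u : G → ℂ) * (Φ.symm v : G → ℂ) := by
    intro u v w hw
    let p : segalAlgebra μ I := ⟨(Φ.symm u : G → ℂ) * (Φ.symm v : G → ℂ),
      mul_mem_segalAlgebra hI _ (segalAlgebra_subset_fourierAlgebra hI (Φ.symm u).2) _
        (Φ.symm v).2⟩
    have hp : Φ p = w := by
      ext1
      rw [hmul (Φ.symm u) (Φ.symm v) p rfl, hw]
      simp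
    rw [← hp, LinearEquiv.symm_apply_apply]
  obtain ⟨α, hαc, hα⟩ := exists_continuous_eq_comp hI hJ Φ hmul
  obtain ⟨β, hβc, hβ⟩ := exists_continuous_eq_comp hJ hI Φ.symm hmul'
  let a : H ≃ₜ G :=
    { toFun := α
      invFun := β
      left_inv := comp_eq_id_of_forall_apply_eq (γ := β ∘ α) hJ fun u x => by
        rw [Function.comp_apply, ← hβ, ← hα]
        simp
      right_inv := comp_eq_id_of_forall_apply_eq (γ := α ∘ β) hI fun u x => by
        rw [Function.comp_apply, ← hα, ← hβ]
        simp
      continuous_toFun := hαc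
      continuous_invFun := hβc }
  have hdiv : ∀ k h, α (k⁻¹ * h) = (α k)⁻¹ * α h := map_inv_mul_of_groupConv hI a Φ hα hconv
  have hone : α 1 = 1 := by simpa using hdiv 1 1
  have hinv : ∀ k, α k⁻¹ = (α k)⁻¹ := fun k => by simpa [hone] using hdiv k 1
  exact ⟨{ a with map_mul' := fun k h => by simpa [hinv, a] using hdiv k⁻¹ h },
    fun u => funext fun h => hα u h⟩
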